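/- Setting. Let $E_0>E$ be real, $\Delta=E_0-E>0$, $\beta>0$, $\lambda\in\mathbb R\setminus\{0\}$. A three-level system with orthonormal energy basis $\varphi_1,\varphi_2,\varphi_3$ and Hamiltonian $H_S(\sigma)=\mathrm{diag}(E_0,E+\sigma/2,E-\sigma/2)$ is coupled, through $\lambda\,G\otimes\varphi(g)$ with $G=\begin{pmatrix}0&1&1\\1&0&0\\1&0&0\end{pmatrix}$, to an infinitely extended thermal Bose field at inverse temperature $\beta$ with form factor $g:\mathbb R^3\to\mathbb C$. Write $J(\omega)=\frac{\pi}{2}\omega^2\int_{S^2}|g(\omega,\Sigma)|^2d\Sigma$ for the spectral density, and $$g_\beta(u,\Sigma)=\sqrt{\tfrac{u}{1-e^{-\beta u}}}\,|u|^{1/2}\begin{cases}g(u,\Sigma)&u\ge0\\-\overline{g(-u,\Sigma)}&u<0\end{cases}$$ for the thermal form factor. Assume that $g_\beta\in L^2(\mathbb R\times S^2)$ (equivalently $g,\ |k|^{-1/2}g\in L^2(\mathbb R^3)$), that $J$ satisfies a Hölder estimate $|J(\omega)-J(\Delta)|\le C|\omega-\Delta|^a$, $a>0$, for $\omega$ near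 $\Delta$, and that $J(\Delta)>0$. The Liouville operator on $\mathbb C^3\otimes\mathbb C^3\otimes\mathcal F$, with $\mathcal F$ the bosonic Fock space over $L^2(\mathbb R\times S^2)$ and $\Omega$ its vacuum, is $L(\sigma,\lambda)=L_S(\sigma)+L_R+\lambda I$, where $L_S(\sigma)=H_S(\sigma)\otimes 1-1\otimes H_S(\sigma)$, $L_R=d\Gamma(u)$ and $$I=G\otimes1\otimes\varphi(g_\beta)-1\otimes G\otimes J_Re^{-\beta L_R/2}\varphi(g_\beta)J_Re^{-\beta L_R/2},\qquad \varphi(f)=\tfrac{1}{\sqrt2}\big(a^*(f)+a(f)\big),$$ with $J_R$ the modular conjugation: $(J_R\Psi)_n(u_1,\Sigma_1,\dots,u_n,\Sigma_n)=(-1)^n\,\overline{\Psi_n(-u_1,\Sigma_1,\dots,-u_n,\Sigma_n)}$. For $e\in\{0,\Delta,-\Delta\}$ let $P_e=\chi(L_S(0)=e)\otimes|\Omega\rangle\langle\Omega|$, $\overline P_e=1-P_e$, and let $$\Lambda_e=\lim_{\epsilon\to0^+}P_e\Big(L(\sigma,\lambda)-L(\sigma,\lambda)\overline P_e\,(L(0,0)-e+i\epsilon)^{-1}\,\overline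 P_eL(\sigma,\lambda)\Big)P_e$$ be the level shift operators on $\mathrm{Ran}\,P_e\subset\mathbb C^3\otimes\mathbb C^3$. Set $U(t)=\bigoplus_e e^{it\Lambda_e}$ (that is, $\sum e^{it\varepsilon}P$ over the eigenvalues $\varepsilon$ and eigenprojections $P$ of the $\Lambda_e$). With $\psi_{\rm ref}=\frac1{\sqrt3}\sum_j\varphi_j\otimes\varphi_j$, the approximate dynamics $T_t$ is defined by $$\mathrm{Tr}(T_t(\rho)A)=\big\langle\psi_\rho,\ B\,U(t)\,(X_\sigma AX_\sigma\otimes 1)\,\psi_{\rm ref}\big\rangle\qquad\text{for all }A\in M_3(\mathbb C),$$ where $\psi_\rho\in\mathbb C^3\otimes\mathbb C^3$ satisfies $\mathrm{Tr}(\rho A)=\langle\psi_\rho,(A\otimes1)\psi_\rho\rangle$ for all $A$, $B=1\otimes b$ is the operator of this form with $B\psi_{\rm ref}=\psi_\rho$, and $X_\sigma=\sqrt{Z_0/Z_\sigma}\,\mathrm{diag}(1,e^{-\beta\sigma/4},e^{\beta\sigma/4})$ with $Z_\sigma=\mathrm{Tr}\,e^{-\beta H_S(\sigma)}$ (so $X_0=1$).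 Proposition 3 (Invariant states). Let $\sigma=0$ (degenerate system). Then the limits defining $\Lambda_0,\Lambda_\Delta,\Lambda_{-\Delta}$ exist, and a complex $3\times3$ matrix $\rho$ is a density matrix with $T_t(\rho)=\rho$ for all $t\ge0$ if and only if, in the basis $\varphi_1,\varphi_2,\varphi_3$, $$\rho=\begin{pmatrix}p&0&0\\0&\frac12(1-p)&\alpha\\0&\alpha&\frac12(1-p)\end{pmatrix},\qquad p\in\big[0,(e^{\beta\Delta}+1)^{-1}\big],\quad\alpha=\tfrac12\big((2e^{\beta\Delta}+1)p-1\big).$$ Equivalently, $\rho=\mu\,\rho_{S,\beta,0}+(1-\mu)\,|\tau\rangle\langle\tau|$ with $0\le\mu\le\frac{1+2e^{\beta\Delta}}{1+e^{\beta\Delta}}$, where $\rho_{S,\beta,0}=e^{-\beta H_S(0)}/\mathrm{Tr}\,e^{-\beta H_S(0)}$ is the Gibbs state and $\tau=(\varphi_2-\varphi_3)/\sqrt2$. (Here $p=\mu/(1+2e^{\beta\Delta})$.) -/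

import Mathlib

open Filter Topology MeasureTheory
open scoped ComplexConjugate Matrix ComplexOrder MatrixOrder

noncomputable section

namespace ThreeLevel

/-! The reservoir: bosonic Fock space over the glued one-particle space `L²(ℝ × S²)`. -/

/-- The unit sphere `S²` of momentum directions. -/
abbrev Sphere2 : Type := Metric.sphere (0 : EuclideanSpace ℝ (Fin 3)) 1

/-- The surface measure `dΣ` on `S²`. -/
def sphereMeasure : Measure Sphere2 :=
  (volume : Measure (EuclideanSpace ℝ (Fin 3))).toSphere

/-- Points `(u, Σ)` of `ℝ × S²`. -/
abbrev Mode : Type := ℝ × Sphere2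

/-- The measure `du × dΣ` on `ℝ × S²`. -/
def modeMeasure : Measure Mode := (volume : Measure ℝ).prod sphereMeasure

/-- Fock space vectors, as sequences of `n`-particle wave functions. The (unbounded) operators below
are given by their usual formulas on wave functions. -/
abbrev Fock : Type := (n : ℕ) → (Fin n → Mode) → ℂ

/-- The vacuum vector `Ω`. -/
def vacuum : Fock
  | 0 => fun _ => 1
  | _ + 1 => fun _ => 0

/-- The projection `P_Ω = |Ω⟩⟨Ω|`. -/
def vacuumProj (ψ : Fock) : Fock := fun n x => ψ 0 Fin.elim0 * vacuum n x

/-- The creation operator `a*(f)`. -/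
def creation (f : Mode → ℂ) (ψ : Fock) : Fock
  | 0 => fun _ => 0
  | n + 1 => fun x =>
      ((Real.sqrt (n + 1) : ℝ) : ℂ)⁻¹ * ∑ j : Fin (n + 1), f (x j) * ψ n (fun i => x (j.succAbove i))

/-- The annihilation operator `a(f)`. -/
def annihilation (f : Mode → ℂ) (ψ : Fock) : Fock := fun n x =>
  ((Real.sqrt (n + 1) : ℝ) : ℂ) * ∫ y, conj (f y) * ψ (n + 1) (Fin.cons y x) ∂modeMeasure

/-- The field operator `φ(f) = (a*(f) + a(f)) / √2`. -/
def field (f : Mode → ℂ) (ψ : Fock) : Fock :=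
  ((Real.sqrt 2 : ℝ) : ℂ)⁻¹ • (creation f ψ + annihilation f ψ)

/-- The total energy `u₁ + … + uₙ` by which `L_R = dΓ(u)` multiplies. -/
def fockEnergy {n : ℕ} (x : Fin n → Mode) : ℝ := ∑ i, (x i).1

/-- `L_R = dΓ(u)`. -/
def reservoirLiouvillian (ψ : Fock) : Fock := fun n x => (fockEnergy x : ℂ) * ψ n x

/-- `e^{-β L_R / 2}`, the square root of the modular operator. -/
def modularSqrt (β : ℝ) (ψ : Fock) : Fock := fun n x =>
  (Real.exp (-β * fockEnergy x / 2) : ℂ) * ψ n x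

/-- The modular conjugation `J_R` of the thermal representation in which the field of a form factor
`g` is `field (thermalFormFactor β g)`. Each particle contributes a sign, matching the sign of
`thermalFormFactor` at `u < 0`: this is what makes `J_R e^{-β L_R / 2} φ(g_β) Ω = φ(g_β) Ω`. -/
def modularConj (ψ : Fock) : Fock := fun n x =>
  (-1) ^ n * conj (ψ n (fun i => (-(x i).1, (x i).2)))

/-- The thermal form factor `g_β` on `ℝ × S²` of a form factor `g` on `ℝ³`. -/
def thermalFormFactor (β : ℝ) (g : EuclideanSpace ℝ (Fin 3) → ℂ) (x : Mode) : ℂ :=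
  ((Real.sqrt (x.1 / (1 - Real.exp (-β * x.1))) * Real.sqrt |x.1| : ℝ) : ℂ) *
    if 0 ≤ x.1 then g (x.1 • (x.2 : EuclideanSpace ℝ (Fin 3)))
    else -conj (g ((-x.1) • (x.2 : EuclideanSpace ℝ (Fin 3))))

/-- The spectral density `J(ω) = (π/2) ω² ∫_{S²} |g(ω, Σ)|² dΣ`. -/
def spectralDensity (g : EuclideanSpace ℝ (Fin 3) → ℂ) (ω : ℝ) : ℝ :=
  Real.pi / 2 * ω ^ 2 * ∫ s : Sphere2, ‖g (ω • (s : EuclideanSpace ℝ (Fin 3)))‖ ^ 2 ∂sphereMeasure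

/-! The three-level system. -/

/-- The parameters of the model: energies `E₀`, `E`, inverse temperature `β`, form factor `g`. -/
structure Params where
  E₀ : ℝ
  E : ℝ
  β : ℝ
  g : EuclideanSpace ℝ (Fin 3) → ℂ

/-- The gap `Δ = E₀ - E`. -/
def Params.gap (M : Params) : ℝ := M.E₀ - M.E

/-- The energy levels of `H_S(σ)`. -/
def Params.energy (M : Params) (σ : ℝ) : Fin 3 → ℝ := ![M.E₀, M.E + σ / 2, M.E - σ / 2]

/-- The system Hamiltonian `H_S(σ)`. -/
def Params.hamiltonian (M : Params) (σ : ℝ) : Matrix (Fin 3) (Fin 3) ℂ :=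
  Matrix.diagonal fun j => (M.energy σ j : ℂ)

/-- The coupling matrix `G`. -/
def coupling : Matrix (Fin 3) (Fin 3) ℂ := !![0, 1, 1; 1, 0, 0; 1, 0, 0]

/-- The Gibbs state `e^{-β H_S(σ)} / Tr e^{-β H_S(σ)}`. -/
def Params.gibbs (M : Params) (σ : ℝ) : Matrix (Fin 3) (Fin 3) ℂ :=
  (Matrix.trace (NormedSpace.exp ((-M.β : ℂ) • M.hamiltonian σ)))⁻¹ •
    NormedSpace.exp ((-M.β : ℂ) • M.hamiltonian σ)

/-- The dark state vector `τ = (φ₂ - φ₃) / √2`. -/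
def darkVector : Fin 3 → ℂ := ((Real.sqrt 2 : ℝ) : ℂ)⁻¹ • ![0, 1, -1]

/-- The dark state `|τ⟩⟨τ|`. -/
def darkState : Matrix (Fin 3) (Fin 3) ℂ := Matrix.vecMulVec darkVector (star darkVector)

/-- Density matrices. -/
def IsDensityMatrix (ρ : Matrix (Fin 3) (Fin 3) ℂ) : Prop := ρ.PosSemidef ∧ ρ.trace = 1

/-! The Liouville operator on `ℂ³ ⊗ ℂ³ ⊗ 𝓕` and the level shift operators. -/

/-- Vectors of `ℂ³ ⊗ ℂ³ ⊗ 𝓕`; the component `Ψ j k` is the coefficient of `φ_j ⊗ φ_k`. -/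
abbrev FullSpace : Type := Fin 3 → Fin 3 → Fock

/-- `M ⊗ 1 ⊗ T`. -/
def leftOp (A : Matrix (Fin 3) (Fin 3) ℂ) (T : Fock → Fock) (Ψ : FullSpace) : FullSpace :=
  fun j k => ∑ l, A j l • T (Ψ l k)

/-- `1 ⊗ M ⊗ T`. -/
def rightOp (A : Matrix (Fin 3) (Fin 3) ℂ) (T : Fock → Fock) (Ψ : FullSpace) : FullSpace :=
  fun j k => ∑ l, A k l • T (Ψ j l)

/-- The interaction
`I = G ⊗ 1 ⊗ φ(g_β) - 1 ⊗ G ⊗ J_R e^{-β L_R / 2} φ(g_β) J_R e^{-β L_R / 2}`. -/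
def Params.interaction (M : Params) (Ψ : FullSpace) : FullSpace :=
  leftOp coupling (field (thermalFormFactor M.β M.g)) Ψ -
    rightOp coupling (fun ψ => modularConj (modularSqrt M.β
      (field (thermalFormFactor M.β M.g) (modularConj (modularSqrt M.β ψ))))) Ψ

/-- The Liouville operator `L(σ, λ) = L_S(σ) + L_R + λ I`. -/
def Params.liouvillian (M : Params) (σ lam : ℝ) (Ψ : FullSpace) : FullSpace :=
  (leftOp (M.hamiltonian σ) id Ψ - rightOp (M.hamiltonian σ) id Ψ) +
    (fun j k => reservoirLiouvillian (Ψ j k)) + (lam : ℂ) • M.interaction Ψ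

/-- `L(0, 0)` is the operator of multiplication by `E_j - E_k + u₁ + … + uₙ`. -/
lemma Params.liouvillian_zero_zero (M : Params) (Ψ : FullSpace) (j k : Fin 3) (n : ℕ)
    (x : Fin n → Mode) : M.liouvillian 0 0 Ψ j k n x =
      ((M.energy 0 j - M.energy 0 k + fockEnergy x : ℝ) : ℂ) * Ψ j k n x := by
  rw [Params.liouvillian, Complex.ofReal_zero, zero_smul, add_zero]
  simp only [leftOp, rightOp, Params.hamiltonian, reservoirLiouvillian, Pi.add_apply, Pi.sub_apply, Finset.sum_apply,
    Pi.smul_apply, smul_eq_mul, Matrix.diagonal_apply, id, ite_mul, zero_mul,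
    Finset.sum_ite_eq, Finset.mem_univ, if_true]
  push_cast
  ring

/-- The resolvent `(L(0,0) - e + iε)⁻¹`. -/
def Params.freeResolvent (M : Params) (e ε : ℝ) (Ψ : FullSpace) : FullSpace := fun j k n x =>
  (((M.energy 0 j - M.energy 0 k + fockEnergy x - e : ℝ) : ℂ) + Complex.I * ε)⁻¹ * Ψ j k n x

/-- `freeResolvent` inverts `L(0,0) - e + iε`. -/
lemma Params.freeResolvent_spec (M : Params) (e ε : ℝ) (hε : 0 < ε) (Ψ : FullSpace) :
    M.liouvillian 0 0 (M.freeResolvent e ε Ψ) + (-(e : ℂ) + Complex.I * ε) • M.freeResolvent e ε Ψ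
      = Ψ := by
  funext j k n x
  have h : (((M.energy 0 j - M.energy 0 k + fockEnergy x - e : ℝ) : ℂ) + Complex.I * ε) ≠ 0 := by
    intro h
    have := congrArg Complex.im h
    simp at this
    exact hε.ne' this
  simp only [Pi.add_apply, Pi.smul_apply, smul_eq_mul, Params.liouvillian_zero_zero,
    Params.freeResolvent]
  rw [← add_mul, ← mul_assoc]
  convert one_mul (Ψ j k n x) using 2
  rw [← mul_inv_cancel₀ h]
  push_cast
  ring

/-- The projection `P_e = χ(L_S(0) = e) ⊗ P_Ω`. -/
def Params.proj (M : Params) (e : ℝ) (Ψ : FullSpace) : FullSpace := fun j k =>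
  if M.energy 0 j - M.energy 0 k = e then vacuumProj (Ψ j k) else 0

/-- The complementary projection `1 - P_e`. -/
def Params.coproj (M : Params) (e : ℝ) (Ψ : FullSpace) : FullSpace := Ψ - M.proj e Ψ

/-- The operator `P_e (L - L (1-P_e) (L(0,0) - e + iε)⁻¹ (1-P_e) L) P_e` with `L = L(σ, λ)`. -/
def Params.regLevelShiftOp (M : Params) (σ lam e ε : ℝ) (Ψ : FullSpace) : FullSpace :=
  M.proj e (M.liouvillian σ lam (M.proj e Ψ) -
    M.liouvillian σ lam (M.coproj e (M.freeResolvent e ε (M.coproj e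
      (M.liouvillian σ lam (M.proj e Ψ))))))

/-- The vector `φ_j ⊗ φ_k ⊗ Ω`. -/
def productVacuum (b : Fin 3 × Fin 3) : FullSpace := fun j k => if (j, k) = b then vacuum else 0

/-- The matrix of `regLevelShiftOp` on `ℂ³ ⊗ ℂ³ ⊗ Ω` in the basis `φ_j ⊗ φ_k ⊗ Ω`. -/
def Params.regLevelShift (M : Params) (σ lam e ε : ℝ) :
    Matrix (Fin 3 × Fin 3) (Fin 3 × Fin 3) ℂ :=
  Matrix.of fun a b => M.regLevelShiftOp σ lam e ε (productVacuum b) a.1 a.2 0 Fin.elim0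

/-- The level shift operator `Λ_e`, the limit `ε → 0+` of the above. It is an operator on `Ran P_e`,
extended by zero to `ℂ³ ⊗ ℂ³`. -/
def Params.levelShift (M : Params) (σ lam e : ℝ) : Matrix (Fin 3 × Fin 3) (Fin 3 × Fin 3) ℂ :=
  limUnder (𝓝[>] (0 : ℝ)) (M.regLevelShift σ lam e)

/-- The direct sum of the level shift operators over the eigenvalues `0, Δ, -Δ` of `L_S(0)`. -/
def Params.totalLevelShift (M : Params) (σ lam : ℝ) : Matrix (Fin 3 × Fin 3) (Fin 3 × Fin 3) ℂ :=
  M.levelShift σ lam 0 + M.levelShift σ lam M.gap + M.levelShift σ lam (-M.gap)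

/-! The approximate dynamics. -/

/-- `U(t) = ∑ e^{i t ε_j^{(s)}} P_j^{(s)}`, written as `exp (i t ⊕_j Λ_j)`. -/
def Params.evolution (M : Params) (σ lam t : ℝ) : Matrix (Fin 3 × Fin 3) (Fin 3 × Fin 3) ℂ :=
  NormedSpace.exp ((Complex.I * t) • M.totalLevelShift σ lam)

/-- Given a spectral decomposition `∑ ε_s P_s`, the exponential above is `∑ e^{i t ε_s} P_s`. -/
lemma exp_spectral {ι κ : Type*} [Fintype ι] [DecidableEq ι] [Fintype κ] [DecidableEq κ]
    (ε : ι → ℂ) (P : ι → Matrix κ κ ℂ) (hP : ∀ s s', P s * P s' = if s = s' then P s else 0)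
    (h1 : ∑ s, P s = 1) (z : ℂ) :
    NormedSpace.exp (z • ∑ s, ε s • P s) = ∑ s, Complex.exp (z * ε s) • P s := by
  let F : (ι → ℂ) →+* Matrix κ κ ℂ :=
    { toFun := fun f => ∑ s, f s • P s
      map_one' := by simpa using h1
      map_zero' := by simp
      map_add' := fun f f' => by simp [add_smul, Finset.sum_add_distrib]
      map_mul' := fun f f' => by
        simp [Finset.sum_mul, Finset.mul_sum, hP, smul_smul, mul_comm] }
  have hF : Continuous F := by
    change Continuous fun f : ι → ℂ => ∑ s, f s • P s
    fun_prop
  have h : F (NormedSpace.exp fun s => z * ε s) = NormedSpace.exp (F fun s => z * ε s) := by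
    let : NormedRing (Matrix κ κ ℂ) := Matrix.linftyOpNormedRing
    let : NormedAlgebra ℂ (Matrix κ κ ℂ) := Matrix.linftyOpNormedAlgebra
    exact NormedSpace.map_exp F hF (fun s => z * ε s)
  have h2 : F (fun s => z * ε s) = z • ∑ s, ε s • P s := by
    change ∑ s, (z * ε s) • P s = _
    simp [Finset.smul_sum, smul_smul]
  rw [← h2, ← h, Pi.exp_def]
  change ∑ s, NormedSpace.exp (z * ε s) • P s = _
  simp [Complex.exp_eq_exp_ℂ]

/-- Vectors of `ℂ³ ⊗ ℂ³`. -/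
abbrev Pair : Type := Fin 3 × Fin 3 → ℂ

/-- The vector `(A ⊗ 1) v`. -/
def leftAct (A : Matrix (Fin 3) (Fin 3) ℂ) (v : Pair) : Pair := fun a => ∑ l, A a.1 l * v (l, a.2)

/-- The vector `(1 ⊗ A) v`. -/
def rightAct (A : Matrix (Fin 3) (Fin 3) ℂ) (v : Pair) : Pair := fun a => ∑ l, A a.2 l * v (a.1, l)

/-- The reference vector `ψ_ref = (1/√3) ∑_j φ_j ⊗ φ_j`. -/
def refVector : Pair := fun a => if a.1 = a.2 then ((Real.sqrt 3 : ℝ) : ℂ)⁻¹ else 0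

/-- A vector `ψ` represents `ρ` if `Tr(ρ A) = ⟨ψ, (A ⊗ 1) ψ⟩` for all `A`. -/
def Represents (ψ : Pair) (ρ : Matrix (Fin 3) (Fin 3) ℂ) : Prop :=
  ∀ A : Matrix (Fin 3) (Fin 3) ℂ, (ρ * A).trace = star ψ ⬝ᵥ leftAct A ψ

/-- The vector `ψ_S = ∑ (√ρ)_{jk} φ_j ⊗ φ_k`, representing `ρ`. -/
def stateVector (ρ : Matrix (Fin 3) (Fin 3) ℂ) : Pair := fun a => CFC.sqrt ρ a.1 a.2

/-- The unique matrix `b` with `(1 ⊗ b) ψ_ref = ψ`. -/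
def refMatrix (ψ : Pair) : Matrix (Fin 3) (Fin 3) ℂ :=
  Matrix.of fun k j => ((Real.sqrt 3 : ℝ) : ℂ) * ψ (j, k)

lemma rightAct_refMatrix (ψ : Pair) : rightAct (refMatrix ψ) refVector = ψ := by
  have h3 : ((Real.sqrt 3 : ℝ) : ℂ) ≠ 0 := by
    exact_mod_cast (Real.sqrt_pos.mpr (by norm_num : (0 : ℝ) < 3)).ne'
  funext ⟨j, k⟩
  simp only [rightAct, refMatrix, refVector, Matrix.of_apply, mul_ite, mul_zero,
    Finset.sum_ite_eq, Finset.mem_univ, if_true]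
  field_simp

lemma represents_stateVector {ρ : Matrix (Fin 3) (Fin 3) ℂ} (hρ : ρ.PosSemidef) :
    Represents (stateVector ρ) ρ := by
  intro A
  have h1 : CFC.sqrt ρ * CFC.sqrt ρ = ρ := CFC.sqrt_mul_sqrt_self ρ hρ.nonneg
  have h2 : (CFC.sqrt ρ)ᴴ = CFC.sqrt ρ := 
    (Matrix.nonneg_iff_posSemidef.mp (CFC.sqrt_nonneg ρ)).isHermitian
  have h3 : star (stateVector ρ) ⬝ᵥ leftAct A (stateVector ρ)
      = ((CFC.sqrt ρ)ᴴ * (A * CFC.sqrt ρ)).trace := by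
    simp only [dotProduct, Fintype.sum_prod_type, leftAct, stateVector, Matrix.trace,
      Matrix.diag_apply, Matrix.mul_apply, Matrix.conjTranspose_apply, Pi.star_apply]
    rw [Finset.sum_comm]
  rw [h3, h2, Matrix.trace_mul_comm (CFC.sqrt ρ), Matrix.mul_assoc, h1, Matrix.trace_mul_comm]

/-- The partition function of `H_S(σ)`. -/
def Params.partition (M : Params) (σ : ℝ) : ℝ := ∑ j, Real.exp (-M.β * M.energy σ j)

/-- The matrix `X_σ`, for which `X_σ ρ_{S,β,0} X_σ = ρ_{S,β,σ}`. -/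
def Params.correction (M : Params) (σ : ℝ) : Matrix (Fin 3) (Fin 3) ℂ :=
  ((Real.sqrt (M.partition 0 / M.partition σ) : ℝ) : ℂ) •
    Matrix.diagonal
      ![1, (Real.exp (-M.β * σ / 4) : ℂ), (Real.exp (M.β * σ / 4) : ℂ)]

/-- The functional
`A ↦ ∑ e^{i t ε_j^{(s)}} χ_j^{(s)}(A) = ⟨ψ, B U(t) (X_σ A X_σ ⊗ 1) ψ_ref⟩`, where `B = 1 ⊗ b` and
`B ψ_ref = ψ`. -/
def Params.resonanceFunctional (M : Params) (σ lam t : ℝ) (ψ : Pair)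
    (A : Matrix (Fin 3) (Fin 3) ℂ) : ℂ :=
  star ψ ⬝ᵥ rightAct (refMatrix ψ) (M.evolution σ lam t *ᵥ
    leftAct (M.correction σ * A * M.correction σ) refVector)

/-- The approximate dynamics `T_t`: `T_t(ρ)` is the matrix with
`Tr(T_t(ρ) A) = ∑ e^{i t ε_j^{(s)}} χ_j^{(s)}(A)` for all `A`, so its `(k, l)` entry is the value at
`A = |φ_l⟩⟨φ_k|`. -/
def Params.approxDynamics (M : Params) (σ lam t : ℝ) (ρ : Matrix (Fin 3) (Fin 3) ℂ) :
    Matrix (Fin 3) (Fin 3) ℂ :=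
  Matrix.of fun k l =>
    M.resonanceFunctional σ lam t (stateVector ρ) (Matrix.single l k 1)

/-- The functional depends on `ψ` only through the state that `ψ` represents. -/
lemma Params.resonanceFunctional_eq (M : Params) (σ lam t : ℝ)
    {ρ : Matrix (Fin 3) (Fin 3) ℂ} {ψ : Pair} (hψ : Represents ψ ρ)
    (A : Matrix (Fin 3) (Fin 3) ℂ) :
    M.resonanceFunctional σ lam t ψ A = ((Real.sqrt 3 : ℝ) : ℂ) * ∑ j, ∑ l, ρ l j *
      (M.evolution σ lam t *ᵥ leftAct (M.correction σ * A * M.correction σ) refVector) (j, l) := by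
  have hentry : ∀ l j, ρ l j = ∑ k, star (ψ (j, k)) * ψ (l, k) := by
    intro l j
    have := hψ (Matrix.single j l 1)
    rw [Matrix.trace_mul_single] at this
    rw [MulOpposite.op_one, one_smul] at this
    rw [this]
    simp only [dotProduct, Fintype.sum_prod_type, leftAct, Matrix.single_apply, Pi.star_apply,
      ite_and, ite_mul, one_mul, zero_mul]
    simp
  unfold Params.resonanceFunctional
  generalize M.evolution σ lam t *ᵥ leftAct (M.correction σ * A * M.correction σ) refVector = v
  simp only [dotProduct, Fintype.sum_prod_type, rightAct, refMatrix, Matrix.of_apply,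
    Pi.star_apply, hentry, Finset.mul_sum, Finset.sum_mul]
  refine Finset.sum_congr rfl fun j _ => ?_
  rw [Finset.sum_comm]
  refine Finset.sum_congr rfl fun l _ => Finset.sum_congr rfl fun k _ => ?_
  ring

/-- `T_t(ρ)` satisfies its defining relation for all observables, and whichever vector is taken to
represent `ρ`. -/
lemma Params.trace_approxDynamics (M : Params) (σ lam t : ℝ) {ρ : Matrix (Fin 3) (Fin 3) ℂ}
    (hρ : ρ.PosSemidef) (ψ : Pair) (hψ : Represents ψ ρ) (A : Matrix (Fin 3) (Fin 3) ℂ) :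
    (M.approxDynamics σ lam t ρ * A).trace = M.resonanceFunctional σ lam t ψ A := by
  have key : ∀ A, M.resonanceFunctional σ lam t (stateVector ρ) A
      = M.resonanceFunctional σ lam t ψ A := fun A => by
    rw [M.resonanceFunctional_eq σ lam t (represents_stateVector hρ),
      M.resonanceFunctional_eq σ lam t hψ]
  let F : Matrix (Fin 3) (Fin 3) ℂ →ₗ[ℂ] ℂ :=
    { toFun := M.resonanceFunctional σ lam t ψ
      map_add' := fun A B => by
        simp only [M.resonanceFunctional_eq σ lam t hψ, Matrix.mul_add, Matrix.add_mul]
        have : ∀ C D : Matrix (Fin 3) (Fin 3) ℂ, leftAct (C + D) refVector =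
            leftAct C refVector + leftAct D refVector := fun C D => by
          funext a; simp [leftAct, add_mul, Finset.sum_add_distrib]
        simp only [this, Matrix.mulVec_add, Pi.add_apply, mul_add, Finset.sum_add_distrib]
      map_smul' := fun c A => by
        simp only [M.resonanceFunctional_eq σ lam t hψ, Matrix.mul_smul, Matrix.smul_mul]
        have : ∀ C : Matrix (Fin 3) (Fin 3) ℂ, leftAct (c • C) refVector =
            c • leftAct C refVector := fun C => by
          funext a; simp [leftAct, Finset.mul_sum, mul_assoc]
        simp only [this, Matrix.mulVec_smul, Pi.smul_apply, smul_eq_mul, RingHom.id_apply,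
          Finset.mul_sum]
        refine Finset.sum_congr rfl fun j _ => Finset.sum_congr rfl fun l _ => ?_
        ring }
  change _ = F A
  conv_rhs => rw [Matrix.matrix_eq_sum_single A]
  simp only [map_sum]
  have hF : ∀ k l, F (Matrix.single l k (A l k)) = M.approxDynamics σ lam t ρ k l * A l k := by
    intro k l
    have : Matrix.single l k (A l k) = A l k • Matrix.single l k (1 : ℂ) := by simp
    rw [this, map_smul, smul_eq_mul, mul_comm, Params.approxDynamics, Matrix.of_apply, key]
    rfl
  simp only [hF, Matrix.trace, Matrix.diag_apply, Matrix.mul_apply]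
  rw [Finset.sum_comm]

end ThreeLevel

end

noncomputable section

namespace ThreeLevel

/-! The regularised level shift operators in closed form. -/

/-! The proof turns the level shift operators into explicit matrices and computes the row vectors
they annihilate. The interaction sends `φ_j ⊗ φ_k ⊗ Ω` into the one-particle sector, and both of its
fields create the same vector `g_β`; hence only the commutator with `G` appears
(`Params.interaction_productVacuum`). The free resolvent multiplies that sector by `(ω + u + iε)⁻¹`,
so `Params.regLevelShift_apply` expresses everything through Cauchy integrals of `|g_β|²`. Those
with the weight `e^{-βu}`, from the right coupling, are minus conjugates of those without it
(`Params.selfEnergy_exp`).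

`G` joins only the excited level to the ground levels, so only the frequencies `±Δ` matter. There
the Hölder condition gives Sokhotski–Plemelj limits `s - ic` and `r - id`. Detailed balance `h(-u) =
e^{-βu} h(u)` for the thermal density gives `d = e^{βΔ} c`, and `J(Δ) > 0` gives `c > 0`
(`Params.exists_tendsto_selfEnergy`).

Differentiating at `t = 0`, invariance means that the transpose of `ρ`, read as a row vector,
annihilates `⊕_e Λ_e`. The blocks `±Δ` are symmetric systems with strictly positive decay rates,
which forces the coherences with the excited level to vanish. The block `0` leaves `ρ₂₂ = ρ₃₃`, `ρ₂₃
= ρ₃₂` and the balance `c(ρ₂₂ + ρ₂₃) = d ρ₁₁` (`vecMul_shift_eq_zero_iff`): only the symmetric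
ground state exchanges energy with the field, while `τ` is dark. Unit trace leaves one parameter,
and positivity in the direction `τ` bounds it (`density_kernel_iff`). -/

lemma exp_half_mul_sqrt_sub {β u : ℝ} (hβ : 0 < β) :
    Real.sqrt (-u / (1 - Real.exp (-β * -u))) =
      Real.exp (-β * u / 2) * Real.sqrt (u / (1 - Real.exp (-β * u))) := by
  rcases eq_or_ne u 0 with rfl | hu
  -- At `u = 0` the quotient is `0 / 0 = 0`, so both sides vanish.
  · simp
  have hx : Real.exp (-β * u) - 1 ≠ 0 := by
    rw [sub_ne_zero, Ne, Real.exp_eq_one_iff]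
    exact mul_ne_zero (neg_ne_zero.2 hβ.ne') hu
  have e1 : Real.exp (-β * -u) = (Real.exp (-β * u))⁻¹ := by
    rw [← Real.exp_neg]; congr 1; ring
  have e2 : Real.exp (-β * u / 2) = Real.sqrt (Real.exp (-β * u)) := Real.exp_half _
  rw [e1, e2, ← Real.sqrt_mul (Real.exp_pos _).le]
  congr 1
  have h0 := (Real.exp_pos (-β * u)).ne'
  have hx' : 1 - Real.exp (-β * u) ≠ 0 := fun h => hx (by linarith)
  have h1 : 1 - (Real.exp (-β * u))⁻¹ = -((1 - Real.exp (-β * u)) / Real.exp (-β * u)) := by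
    rw [sub_div, div_self h0, one_div]; ring
  rw [h1, neg_div_neg_eq, div_div_eq_mul_div, mul_comm, mul_div_assoc]

/-- The reflection symmetry of the thermal form factor. -/
lemma thermalFormFactor_neg {β : ℝ} (hβ : 0 < β) (g : EuclideanSpace ℝ (Fin 3) → ℂ) (u : ℝ)
    (s : Sphere2) : thermalFormFactor β g (-u, s) =
      -((Real.exp (-β * u / 2) : ℝ) : ℂ) * conj (thermalFormFactor β g (u, s)) := by
  rcases eq_or_ne u 0 with rfl | hu
  · simp [thermalFormFactor]
  simp only [thermalFormFactor, exp_half_mul_sqrt_sub hβ, abs_neg, neg_neg, map_mul,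
    Complex.conj_ofReal]
  rcases lt_or_gt_of_ne hu with h | h
  · rw [if_pos (by linarith), if_neg (by linarith)]
    push_cast
    simp
    ring
  · rw [if_neg (by linarith), if_pos h.le]
    push_cast
    ring

lemma exp_half_neg_mul (β u : ℝ) :
    Real.exp (-β * -u / 2) * Real.exp (-β * u / 2) = 1 := by
  rw [← Real.exp_add, Real.exp_eq_one_iff]; ring

@[simp] lemma fockEnergy_one (x : Fin 1 → Mode) : fockEnergy x = (x 0).1 := by
  simp [fockEnergy]

/-! ### Action of the two fields on the vacuum and one-particle sectors. -/

/-- The vector with `z` in the vacuum sector, `f` in the one-particle sector, `0` elsewhere. -/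
def lowFock (z : ℂ) (f : Mode → ℂ) : Fock
  | 0 => fun _ => z
  | 1 => fun x => f (x 0)
  | _ + 2 => fun _ => 0

lemma vacuum_eq_lowFock : vacuum = lowFock 1 0 := by
  funext n x
  match n with
  | 0 => rfl
  | 1 => rfl
  | n + 2 => rfl

lemma zero_eq_lowFock : (0 : Fock) = lowFock 0 0 := by
  funext n x
  match n with
  | 0 => rfl
  | 1 => rfl
  | n + 2 => rfl

lemma modularConj_modularSqrt_lowFock (β : ℝ) (z : ℂ) (f : Mode → ℂ) :
    modularConj (modularSqrt β (lowFock z f)) =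
      lowFock (conj z) fun y => -((Real.exp (-β * -y.1 / 2) : ℝ) : ℂ) * conj (f (-y.1, y.2)) := by
  funext n x
  match n with
  | 0 => simp [modularConj, modularSqrt, lowFock, fockEnergy]
  | 1 =>
    simp only [modularConj, modularSqrt, lowFock, fockEnergy_one, map_mul, Complex.conj_ofReal]
    ring
  | n + 2 => simp [modularConj, modularSqrt, lowFock]

lemma field_lowFock_zero_right (f : Mode → ℂ) (z : ℂ) :
    field f (lowFock z 0) = lowFock 0 fun y => ((Real.sqrt 2 : ℝ) : ℂ)⁻¹ * z * f y := by
  funext n x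
  match n with
  | 0 => simp [field, creation, annihilation, lowFock]
  | 1 => simp [field, creation, annihilation, lowFock]; ring
  | n + 2 =>
    have : ∀ j : Fin (n + 2), lowFock z 0 (n + 1) (fun i => x (j.succAbove i)) = 0 := by
      intro j
      cases n <;> rfl
    have h2 : lowFock z 0 (n + 3) = 0 := rfl
    simp only [field, Pi.smul_apply, Pi.add_apply, creation, annihilation, this, h2]
    simp [lowFock]

/-- Only the vacuum component is computed: the two-particle part is removed by the final projection
`P_e`. -/
lemma field_lowFock_zero_left (f k : Mode → ℂ) (x : Fin 0 → Mode) :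
    field f (lowFock 0 k) 0 x = ((Real.sqrt 2 : ℝ) : ℂ)⁻¹ * ∫ y, conj (f y) * k y ∂modeMeasure := by
  simp [field, creation, annihilation, lowFock]

/-- The field operator `J_R e^{-β L_R / 2} φ(f) J_R e^{-β L_R / 2}` of the commutant. -/
def commutantField (β : ℝ) (f : Mode → ℂ) (ψ : Fock) : Fock :=
  modularConj (modularSqrt β (field f (modularConj (modularSqrt β ψ))))

/-- The modular relation `J_R e^{-βL_R/2} φ(g_β) Ω = φ(g_β) Ω`: the factor `-e^{-βu/2}` in the
reflection of `g_β` cancels the exponential of the modular operator and the one-particle sign of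
`J_R`. -/
lemma commutantField_lowFock_zero_right {β : ℝ} (hβ : 0 < β) (g : EuclideanSpace ℝ (Fin 3) → ℂ)
    (z : ℂ) : commutantField β (thermalFormFactor β g) (lowFock z 0) =
      lowFock 0 fun y => ((Real.sqrt 2 : ℝ) : ℂ)⁻¹ * z * thermalFormFactor β g y := by
  unfold commutantField
  rw [modularConj_modularSqrt_lowFock]
  have h0 : (fun y : Mode => -((Real.exp (-β * -y.1 / 2) : ℝ) : ℂ) *
      conj ((0 : Mode → ℂ) (-y.1, y.2))) = 0 := by
    funext y; simp
  rw [h0, field_lowFock_zero_right, modularConj_modularSqrt_lowFock, map_zero]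
  congr 1
  funext y
  have h1 : ((Real.exp (-β * -y.1 / 2) : ℝ) : ℂ) * ((Real.exp (-β * y.1 / 2) : ℝ) : ℂ) = 1 := by
    exact_mod_cast exp_half_neg_mul β y.1
  rw [thermalFormFactor_neg hβ]
  simp only [map_mul, map_neg, map_inv₀, Complex.conj_ofReal, Complex.conj_conj]
  linear_combination (((Real.sqrt 2 : ℝ) : ℂ)⁻¹ * z * thermalFormFactor β g y) * h1

lemma integral_comp_reflect (k : Mode → ℂ) :
    ∫ y, k (-y.1, y.2) ∂modeMeasure = ∫ y, k y ∂modeMeasure := by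
  have h : MeasurePreserving (fun y : Mode => (-y.1, y.2)) modeMeasure modeMeasure := by
    have : IsFiniteMeasure sphereMeasure := by unfold sphereMeasure; infer_instance
    exact (Measure.measurePreserving_neg (volume : Measure ℝ)).prod
      (MeasurePreserving.id sphereMeasure)
  exact h.integral_comp ((MeasurableEquiv.neg ℝ).prodCongr (MeasurableEquiv.refl _)).measurableEmbedding k

/-- The weight `e^{-βu}` is a product of two half powers, one from the inner modular operator and
one from reflecting `g_β` in the substitution `u ↦ -u`. -/
lemma commutantField_lowFock_zero_left {β : ℝ} (hβ : 0 < β) (g : EuclideanSpace ℝ (Fin 3) → ℂ)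
    (k : Mode → ℂ) (x : Fin 0 → Mode) :
    commutantField β (thermalFormFactor β g) (lowFock 0 k) 0 x =
      ((Real.sqrt 2 : ℝ) : ℂ)⁻¹ * ∫ y, ((Real.exp (-β * y.1) : ℝ) : ℂ) *
        (conj (thermalFormFactor β g y) * k y) ∂modeMeasure := by
  unfold commutantField
  rw [modularConj_modularSqrt_lowFock, map_zero]
  simp only [modularConj, modularSqrt, pow_zero, one_mul]
  rw [field_lowFock_zero_left]
  simp only [fockEnergy, Finset.univ_eq_empty, Finset.sum_empty, mul_zero, zero_div, Real.exp_zero,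
    Complex.ofReal_one, one_mul, map_mul, map_inv₀, Complex.conj_ofReal]
  congr 1
  rw [← integral_conj, ← integral_comp_reflect]
  refine integral_congr_ae (Eventually.of_forall fun y => ?_)
  have h1 : ((Real.exp (-β * y.1 / 2) : ℝ) : ℂ) * ((Real.exp (-β * y.1 / 2) : ℝ) : ℂ) =
      ((Real.exp (-β * y.1) : ℝ) : ℂ) := by
    rw [← Complex.ofReal_mul, ← Real.exp_add]; ring_nf
  simp only [map_mul, map_neg, Complex.conj_ofReal, Complex.conj_conj, neg_neg,
    thermalFormFactor_neg hβ, ← h1]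
  ring

/-! ### Second-order expansion on the vacuum sector. -/

/-- The matrix elements of `G ⊗ 1 - 1 ⊗ G` in the basis `φ_j ⊗ φ_k`. -/
def commutatorEntry (b : Fin 3 × Fin 3) (j k : Fin 3) : ℂ :=
  coupling j b.1 * (if k = b.2 then 1 else 0) - coupling k b.2 * (if j = b.1 then 1 else 0)

lemma productVacuum_apply (b : Fin 3 × Fin 3) (j k : Fin 3) :
    productVacuum b j k = lowFock (if (j, k) = b then 1 else 0) 0 := by
  unfold productVacuum
  split_ifs
  · exact vacuum_eq_lowFock
  · exact zero_eq_lowFock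

lemma Params.interaction_productVacuum (M : Params) (hβ : 0 < M.β) (b : Fin 3 × Fin 3)
    (j k : Fin 3) : M.interaction (productVacuum b) j k =
      lowFock 0 fun y => ((Real.sqrt 2 : ℝ) : ℂ)⁻¹ * commutatorEntry b j k *
        thermalFormFactor M.β M.g y := by
  have h : M.interaction (productVacuum b) j k =
      ∑ l, coupling j l • field (thermalFormFactor M.β M.g) (productVacuum b l k) -
      ∑ l, coupling k l • commutantField M.β (thermalFormFactor M.β M.g) (productVacuum b j l) :=
    rfl
  rw [h]
  simp only [productVacuum_apply, field_lowFock_zero_right, commutantField_lowFock_zero_right hβ]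
  obtain ⟨b1, b2⟩ := b
  funext n x
  simp only [Pi.sub_apply, Finset.sum_apply, Pi.smul_apply, smul_eq_mul, commutatorEntry,
    Prod.mk.injEq]
  match n with
  | 0 => simp [lowFock]
  | 1 =>
    simp only [lowFock, mul_ite, mul_one, mul_zero, ite_mul, zero_mul, ite_and]
    by_cases hk : k = b2 <;> by_cases hj : j = b1 <;> simp [hk, hj] <;> ring
  | n + 2 => simp [lowFock]

lemma Params.liouvillian_eq (M : Params) (lam : ℝ) (Ψ : FullSpace) (j k : Fin 3) (n : ℕ)
    (x : Fin n → Mode) : M.liouvillian 0 lam Ψ j k n x =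
      ((M.energy 0 j - M.energy 0 k + fockEnergy x : ℝ) : ℂ) * Ψ j k n x +
        lam * M.interaction Ψ j k n x := by
  rw [← M.liouvillian_zero_zero]
  simp [Params.liouvillian]

/-- The integral `∫ w(u) |g_β(u, Σ)|² (ω + u + iε)⁻¹`. -/
def Params.selfEnergy (M : Params) (w : ℝ → ℝ) (ω ε : ℝ) : ℂ :=
  ∫ y : Mode, ((w y.1 : ℝ) : ℂ) * (conj (thermalFormFactor M.β M.g y) *
    ((((ω + y.1 : ℝ) : ℂ) + Complex.I * ε)⁻¹ * thermalFormFactor M.β M.g y)) ∂modeMeasure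

/-- The second-order part of the level shift operators, for given self-energies `A` and `B` of the
left and right couplings. -/
def shiftEntry (A B : Fin 3 → Fin 3 → ℂ) (a b : Fin 3 × Fin 3) : ℂ :=
  ∑ l, coupling a.1 l * A l a.1 * commutatorEntry b l a.2 -
    ∑ l, coupling a.2 l * B a.2 l * commutatorEntry b a.1 l

lemma vacuumProj_zero : vacuumProj 0 = 0 := by
  funext n x; simp [vacuumProj]

lemma Params.proj_productVacuum (M : Params) (e : ℝ) (b : Fin 3 × Fin 3) :
    M.proj e (productVacuum b) =
      if M.energy 0 b.1 - M.energy 0 b.2 = e then productVacuum b else 0 := by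
  have hv : vacuumProj vacuum = vacuum := by
    funext n x; simp [vacuumProj, vacuum]
  funext j k
  simp only [Params.proj, productVacuum]
  by_cases hjk : (j, k) = b
  · subst hjk
    by_cases h : M.energy 0 j - M.energy 0 k = e
    · simp [h, hv, productVacuum]
    · simp [h]
  · rw [if_neg hjk, vacuumProj_zero, ite_self]
    split_ifs
    · simp [productVacuum, hjk]
    · rfl

lemma Params.liouvillian_map_zero (M : Params) (lam : ℝ) : M.liouvillian 0 lam 0 = 0 := by
  have h1 : ∀ f : Mode → ℂ, field f 0 = 0 := by
    intro f
    funext n x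
    cases n <;> simp [field, creation, annihilation]
  have h2 : ∀ f : Mode → ℂ, modularConj (modularSqrt M.β (field f
      (modularConj (modularSqrt M.β 0)))) = 0 := by
    intro f
    have h3 : modularConj (modularSqrt M.β 0) = 0 := by
      funext n x; simp [modularConj, modularSqrt]
    rw [h3, h1, h3]
  have h3 : M.interaction 0 = 0 := by
    funext j k
    simp [Params.interaction, leftOp, rightOp, h1, h2]
  funext j k n x
  rw [Params.liouvillian_eq, h3]
  simp

/-- `1 - P_e` deletes vacuum components only where `L_S(0) = e`, so the vacuum part has to be
supported there for all of it to disappear. -/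
lemma Params.coproj_lowFock (M : Params) (e : ℝ) (z : Fin 3 → Fin 3 → ℂ)
    (hz : ∀ j k, M.energy 0 j - M.energy 0 k ≠ e → z j k = 0) (f : Fin 3 → Fin 3 → Mode → ℂ) :
    M.coproj e (fun j k => lowFock (z j k) (f j k)) = fun j k => lowFock 0 (f j k) := by
  funext j k n x
  simp only [Params.coproj, Params.proj, Pi.sub_apply]
  by_cases h : M.energy 0 j - M.energy 0 k = e
  · match n with
    | 0 => simp [h, vacuumProj, lowFock, vacuum]
    | 1 => simp [h, vacuumProj, lowFock, vacuum]
    | n + 2 => simp [h, vacuumProj, lowFock, vacuum]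
  · simp [h, hz j k h]

lemma Params.freeResolvent_lowFock (M : Params) (e ε : ℝ) (f : Fin 3 → Fin 3 → Mode → ℂ) :
    M.freeResolvent e ε (fun j k => lowFock 0 (f j k)) = fun j k => lowFock 0 fun y =>
      (((M.energy 0 j - M.energy 0 k + y.1 - e : ℝ) : ℂ) + Complex.I * ε)⁻¹ * f j k y := by
  funext j k n x
  match n with
  | 0 => simp [freeResolvent, lowFock]
  | 1 => simp [freeResolvent, lowFock]
  | n + 2 => simp [freeResolvent, lowFock]

lemma Params.liouvillian_productVacuum (M : Params) (hβ : 0 < M.β) (lam : ℝ) (b : Fin 3 × Fin 3) :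
    M.liouvillian 0 lam (productVacuum b) = fun j k =>
      lowFock (if (j, k) = b then ((M.energy 0 j - M.energy 0 k : ℝ) : ℂ) else 0) fun y =>
        lam * (((Real.sqrt 2 : ℝ) : ℂ)⁻¹ * commutatorEntry b j k *
          thermalFormFactor M.β M.g y) := by
  funext j k n x
  rw [Params.liouvillian_eq, M.interaction_productVacuum hβ, productVacuum_apply]
  match n with
  | 0 => simp [lowFock, fockEnergy]
  | 1 => simp [lowFock]
  | n + 2 => simp [lowFock]

lemma Params.liouvillian_lowFock_vacuum (M : Params) (hβ : 0 < M.β) (lam : ℝ)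
    (f : Fin 3 → Fin 3 → Mode → ℂ) (j k : Fin 3) (x : Fin 0 → Mode) :
    M.liouvillian 0 lam (fun j k => lowFock 0 (f j k)) j k 0 x =
      lam * ((Real.sqrt 2 : ℝ) : ℂ)⁻¹ * (
        ∑ l, coupling j l * ∫ y, conj (thermalFormFactor M.β M.g y) * f l k y ∂modeMeasure -
        ∑ l, coupling k l * ∫ y, ((Real.exp (-M.β * y.1) : ℝ) : ℂ) *
          (conj (thermalFormFactor M.β M.g y) * f j l y) ∂modeMeasure) := by
  rw [Params.liouvillian_eq]
  have h : ∀ Ψ : FullSpace, M.interaction Ψ j k =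
      ∑ l, coupling j l • field (thermalFormFactor M.β M.g) (Ψ l k) -
      ∑ l, coupling k l • commutantField M.β (thermalFormFactor M.β M.g) (Ψ j l) := fun _ =>
    rfl
  rw [h]
  simp only [Pi.sub_apply, Finset.sum_apply, Pi.smul_apply, smul_eq_mul,
    field_lowFock_zero_left, commutantField_lowFock_zero_left hβ]
  simp only [lowFock, mul_zero, zero_add, mul_sub, Finset.mul_sum]
  congr 1 <;> exact Finset.sum_congr rfl fun l _ => by ring

/-- Creating one particle and absorbing it again gives `λ²/2`, one `1/√2` from each field. -/
lemma Params.regLevelShift_apply (M : Params) (hβ : 0 < M.β) (lam e ε : ℝ) (a b : Fin 3 × Fin 3) :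
    M.regLevelShift 0 lam e ε a b =
      if M.energy 0 a.1 - M.energy 0 a.2 = e ∧ M.energy 0 b.1 - M.energy 0 b.2 = e then
        (if a = b then (e : ℂ) else 0) - lam ^ 2 / 2 *
          shiftEntry (fun l m => M.selfEnergy 1 (M.energy 0 l - M.energy 0 m) ε)
            (fun l m => M.selfEnergy (fun u => Real.exp (-M.β * u)) (M.energy 0 l - M.energy 0 m) ε)
            a b
      else 0 := by
  have h2 : ((Real.sqrt 2 : ℝ) : ℂ)⁻¹ * ((Real.sqrt 2 : ℝ) : ℂ)⁻¹ = 1 / 2 := by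
    rw [← mul_inv, ← Complex.ofReal_mul, Real.mul_self_sqrt (by norm_num)]
    norm_num
  simp only [Params.regLevelShift, Matrix.of_apply, Params.regLevelShiftOp,
    Params.proj_productVacuum]
  by_cases hb : M.energy 0 b.1 - M.energy 0 b.2 = e
  swap
  · have h3 : M.coproj e 0 = 0 := by
      funext j k n x; simp [Params.coproj, Params.proj, vacuumProj_zero]
    have h4 : M.freeResolvent e ε 0 = 0 := by
      funext j k n x; simp [Params.freeResolvent]
    have h5 : M.proj e 0 = 0 := by
      funext j k n x; simp [Params.proj, vacuumProj_zero]
    rw [if_neg hb, if_neg (fun h => hb h.2), M.liouvillian_map_zero, h3, h4, h3,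
      M.liouvillian_map_zero, sub_zero, h5]
    rfl
  rw [if_pos hb, M.liouvillian_productVacuum hβ, M.coproj_lowFock, M.freeResolvent_lowFock,
    M.coproj_lowFock _ _ (fun _ _ _ => rfl)]
  swap
  · intro j k hjk
    rw [if_neg]
    rintro rfl
    exact hjk hb
  simp only [Params.proj]
  by_cases ha : M.energy 0 a.1 - M.energy 0 a.2 = e
  swap
  · rw [if_neg ha, if_neg (fun h => ha h.1)]
    rfl
  rw [if_pos ha, if_pos ⟨ha, hb⟩]
  simp only [vacuumProj, vacuum, mul_one, Pi.sub_apply]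
  rw [M.liouvillian_lowFock_vacuum hβ]
  simp only [lowFock, ha, shiftEntry]
  congr 1
  have hA : ∀ l, ∫ y : Mode, conj (thermalFormFactor M.β M.g y) *
      ((((M.energy 0 l - M.energy 0 a.2 + y.1 - e : ℝ) : ℂ) + Complex.I * ε)⁻¹ *
        (lam * (((Real.sqrt 2 : ℝ) : ℂ)⁻¹ * commutatorEntry b l a.2 *
          thermalFormFactor M.β M.g y))) ∂modeMeasure =
      lam * ((Real.sqrt 2 : ℝ) : ℂ)⁻¹ * commutatorEntry b l a.2 *
        M.selfEnergy 1 (M.energy 0 l - M.energy 0 a.1) ε := by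
    intro l
    rw [Params.selfEnergy, ← integral_const_mul]
    refine integral_congr_ae (Eventually.of_forall fun y => ?_)
    -- On `Ran P_e` the energy of the spectator factor cancels against `e`, so the denominator sees
    -- only the transition made by the coupled factor.
    have : M.energy 0 l - M.energy 0 a.2 + y.1 - e = M.energy 0 l - M.energy 0 a.1 + y.1 := by
      rw [← ha]; ring
    simp only [this, Pi.one_apply, Complex.ofReal_one]
    ring
  have hB : ∀ l, ∫ y : Mode, ((Real.exp (-M.β * y.1) : ℝ) : ℂ) *
      (conj (thermalFormFactor M.β M.g y) *
      ((((M.energy 0 a.1 - M.energy 0 l + y.1 - e : ℝ) : ℂ) + Complex.I * ε)⁻¹ *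
        (lam * (((Real.sqrt 2 : ℝ) : ℂ)⁻¹ * commutatorEntry b a.1 l *
          thermalFormFactor M.β M.g y)))) ∂modeMeasure =
      lam * ((Real.sqrt 2 : ℝ) : ℂ)⁻¹ * commutatorEntry b a.1 l *
        M.selfEnergy (fun u => Real.exp (-M.β * u)) (M.energy 0 a.2 - M.energy 0 l) ε := by
    intro l
    rw [Params.selfEnergy, ← integral_const_mul]
    refine integral_congr_ae (Eventually.of_forall fun y => ?_)
    have : M.energy 0 a.1 - M.energy 0 l + y.1 - e = M.energy 0 a.2 - M.energy 0 l + y.1 := by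
      rw [← ha]; ring
    simp only [this]
    ring
  simp only [hA, hB]
  rw [show (lam : ℂ) ^ 2 / 2 = lam ^ 2 * (((Real.sqrt 2 : ℝ) : ℂ)⁻¹ * ((Real.sqrt 2 : ℝ) : ℂ)⁻¹) by
    rw [h2]; ring]
  simp only [mul_sub, Finset.mul_sum]
  congr 1 <;> exact Finset.sum_congr rfl fun l _ => by ring

/-! Boundary values of Cauchy integrals on the real line. -/

lemma add_I_mul_ne_zero (u : ℝ) {ε : ℝ} (hε : 0 < ε) : (u : ℂ) + Complex.I * ε ≠ 0 := by
  intro h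
  have := congrArg Complex.im h
  simp at this
  exact hε.ne' this

lemma norm_inv_add_I_mul_le {u : ℝ} (hu : u ≠ 0) (ε : ℝ) :
    ‖((u : ℂ) + Complex.I * ε)⁻¹‖ ≤ |u|⁻¹ := by
  rw [norm_inv]
  refine inv_anti₀ (abs_pos.2 hu) ?_
  simpa using Complex.abs_re_le_norm ((u : ℂ) + Complex.I * ε)

/-- A primitive is `log (u + iε)`. As `ε → 0+` the endpoint `-δ` approaches the branch cut from
above and contributes `iπ`, while the moduli cancel. -/
lemma tendsto_integral_Ioo_inv {δ : ℝ} (hδ : 0 < δ) :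
    Tendsto (fun ε : ℝ => ∫ u in -δ..δ, ((u : ℂ) + Complex.I * ε)⁻¹) (𝓝[>] 0)
      (𝓝 (-(Complex.I * Real.pi))) := by
  have hI : ∀ ε : ℝ, 0 < ε → ∫ u in -δ..δ, ((u : ℂ) + Complex.I * ε)⁻¹ =
      Complex.log ((δ : ℂ) + Complex.I * ε) - Complex.log (((-δ : ℝ) : ℂ) + Complex.I * ε) := by
    intro ε hε
    refine intervalIntegral.integral_eq_sub_of_hasDerivAt
      (f := fun u : ℝ => Complex.log ((u : ℂ) + Complex.I * ε)) (fun u _ => ?_) ?_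
    · have h1 : HasDerivAt (fun u : ℝ => (u : ℂ) + Complex.I * ε) 1 u :=
        (Complex.ofRealCLM.hasDerivAt (x := u)).add_const _
      have h2 := HasDerivAt.clog_real h1 (Or.inr (by simpa using hε.ne'))
      simpa using h2
    · refine Continuous.intervalIntegrable ?_ _ _
      exact Continuous.inv₀ (by fun_prop) fun u => add_I_mul_ne_zero u hε
  have hcont : ∀ x : ℝ, Tendsto (fun ε : ℝ => (x : ℂ) + Complex.I * ε) (𝓝[>] 0) (𝓝 (x : ℂ)) := by
    intro x
    have : Continuous fun ε : ℝ => (x : ℂ) + Complex.I * ε := by fun_prop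
    simpa using (this.tendsto 0).mono_left nhdsWithin_le_nhds
  have h1 : Tendsto (fun ε : ℝ => Complex.log ((δ : ℂ) + Complex.I * ε)) (𝓝[>] 0)
      (𝓝 (Complex.log δ)) :=
    (continuousAt_clog (Complex.ofReal_mem_slitPlane.2 hδ)).tendsto.comp (hcont δ)
  have h2 : Tendsto (fun ε : ℝ => Complex.log (((-δ : ℝ) : ℂ) + Complex.I * ε)) (𝓝[>] 0)
      (𝓝 (Real.log ‖((-δ : ℝ) : ℂ)‖ + Real.pi * Complex.I)) := by
    have h3 := Complex.tendsto_log_nhdsWithin_im_nonneg_of_re_neg_of_im_zero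
      (z := ((-δ : ℝ) : ℂ)) (by simpa using hδ) (by simp)
    refine h3.comp (tendsto_nhdsWithin_iff.2 ⟨hcont _, ?_⟩)
    filter_upwards [self_mem_nhdsWithin] with ε (hε : 0 < ε)
    simpa using hε.le
  have h4 := h1.sub h2
  have h5 : Complex.log δ - (Real.log ‖((-δ : ℝ) : ℂ)‖ + Real.pi * Complex.I) =
      -(Complex.I * Real.pi) := by
    rw [Complex.norm_real, Real.norm_eq_abs, abs_neg, abs_of_pos hδ, Complex.ofReal_log hδ.le]
    ring
  rw [h5] at h4
  refine h4.congr' ?_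
  filter_upwards [self_mem_nhdsWithin] with ε hε
  rw [hI ε hε]

/-- Dominated convergence with majorant `|k(u)| / |u|`; the pole is a null set. -/
lemma tendsto_integral_mul_inv_of_integrable_div {k : ℝ → ℝ} (hk : AEStronglyMeasurable k)
    (hki : Integrable fun u => k u * |u|⁻¹) :
    Tendsto (fun ε : ℝ => ∫ u, (k u : ℂ) * ((u : ℂ) + Complex.I * ε)⁻¹) (𝓝[>] 0)
      (𝓝 ((∫ u, k u * u⁻¹ : ℝ) : ℂ)) := by
  have hne : ∀ᵐ u : ℝ, u ≠ 0 := by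
    simp [ae_iff]
  rw [← integral_complex_ofReal]
  refine tendsto_integral_filter_of_dominated_convergence (fun u => ‖k u * |u|⁻¹‖) ?_ ?_ hki.norm ?_
  · filter_upwards [self_mem_nhdsWithin] with ε (hε : 0 < ε)
    refine (Complex.continuous_ofReal.comp_aestronglyMeasurable hk).mul ?_
    exact (Continuous.inv₀ (by fun_prop) fun u => add_I_mul_ne_zero u hε).aestronglyMeasurable
  · refine Eventually.of_forall fun ε => ?_
    filter_upwards [hne] with u hu
    rw [norm_mul, norm_mul, Complex.norm_real]
    gcongr
    rw [norm_inv, norm_inv, ← norm_inv, Real.norm_eq_abs, abs_abs]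
    exact norm_inv_add_I_mul_le hu ε
  · filter_upwards [hne] with u hu
    push_cast
    refine Tendsto.const_mul _ ?_
    have hc : ContinuousAt (fun ε : ℝ => ((u : ℂ) + Complex.I * ε)⁻¹) 0 := by
      refine ContinuousAt.inv₀ (by fun_prop) ?_
      simpa using hu
    simpa using hc.tendsto.mono_left nhdsWithin_le_nhds

/-- The Sokhotski–Plemelj formula at `0`. -/
lemma exists_tendsto_cauchy_zero {h : ℝ → ℝ} (hh : Integrable h) {b : ℝ} (hb : 0 < b)
    (hO : (fun u => h u - h 0) =O[𝓝 0] fun u => |u| ^ b) :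
    ∃ a : ℝ, Tendsto (fun ε : ℝ => ∫ u, (h u : ℂ) * ((u : ℂ) + Complex.I * ε)⁻¹) (𝓝[>] 0)
      (𝓝 ((a : ℂ) - Complex.I * (Real.pi * h 0 : ℝ))) := by
  obtain ⟨C, hC⟩ := hO.bound
  obtain ⟨δ, hδ, hball⟩ := Metric.eventually_nhds_iff.1 hC
  set s : Set ℝ := Set.Ioc (-(δ/2)) (δ/2) with hs
  have hδ2 : 0 < δ / 2 := by positivity
  -- The density splits as `(h - q) + q`. The quotient `(h - q) / u` is integrable and gives a real
  -- limit; the constant `q` on a symmetric interval gives exactly `-iπ h(0)`. The radius `δ/2`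
  -- keeps the closed interval inside the ball where the Hölder bound holds.
  set q : ℝ → ℝ := s.indicator fun _ => h 0 with hq
  have hsm : MeasurableSet s := measurableSet_Ioc
  have hqi : Integrable q := by
    rw [hq, integrable_indicator_iff hsm]
    exact integrableOn_const (by simp [hs])
  have hki : Integrable fun u => (h u - q u) * |u|⁻¹ := by
    rw [← integrableOn_univ, ← Set.union_compl_self s]
    refine IntegrableOn.union ?_ ?_
    -- Near the pole the Hölder bound divided by `|u|` is integrable because `b - 1 > -1`; away from
    -- it `|u|⁻¹` is at most `(δ/2)⁻¹`.
    · have hdom : IntegrableOn (fun u : ℝ => C * |u| ^ (b - 1)) s := by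
        refine Integrable.const_mul ?_ C
        have h1 : IntervalIntegrable (fun u : ℝ => |u| ^ (b - 1)) volume 0 (δ/2) := by
          refine (intervalIntegral.intervalIntegrable_rpow' (r := b - 1) (by linarith)).congr ?_
          intro u hu
          rw [Set.uIoc_of_le hδ2.le] at hu
          simp [abs_of_pos hu.1]
        have h2 : IntervalIntegrable (fun u : ℝ => |u| ^ (b - 1)) volume (-(δ/2)) 0 := by
          have := h1.comp_sub_left 0
          simpa using this.symm
        have := h2.trans h1
        rwa [intervalIntegrable_iff_integrableOn_Ioc_of_le (by linarith)] at this
      refine Integrable.mono' hdom ?_ ?_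
      · exact ((hh.sub hqi).aestronglyMeasurable.mul
          (by fun_prop : Measurable fun u : ℝ => |u|⁻¹).aestronglyMeasurable).restrict
      · have hne : ∀ᵐ u ∂(volume.restrict s), u ≠ 0 :=
          ae_restrict_of_ae (by simp [ae_iff])
        filter_upwards [ae_restrict_mem hsm, hne] with u hu hu0
        have hub : dist u 0 < δ := by
          rw [Real.dist_eq, sub_zero, abs_lt]; constructor <;> linarith [hu.1, hu.2]
        have hbd := hball hub
        have hqu : q u = h 0 := by rw [hq, Set.indicator_of_mem hu]
        rw [norm_mul, hqu, norm_inv, Real.norm_eq_abs |u|, abs_abs, Real.rpow_sub_one (abs_pos.2 hu0).ne',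
          mul_div_assoc', div_eq_mul_inv]
        refine mul_le_mul_of_nonneg_right (hbd.trans_eq ?_) (by positivity)
        rw [Real.norm_eq_abs, abs_of_nonneg (by positivity)]
    · have hdom : IntegrableOn (fun u : ℝ => ‖h u - q u‖ * (δ/2)⁻¹) sᶜ :=
        ((hh.sub hqi).norm.mul_const _).integrableOn
      refine Integrable.mono' hdom ?_ ?_
      · exact ((hh.sub hqi).aestronglyMeasurable.mul
          (by fun_prop : Measurable fun u : ℝ => |u|⁻¹).aestronglyMeasurable).restrict
      · filter_upwards [ae_restrict_mem hsm.compl] with u hu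
        rw [norm_mul, norm_inv, Real.norm_eq_abs |u|, abs_abs]
        refine mul_le_mul_of_nonneg_left (inv_anti₀ hδ2 ?_) (norm_nonneg _)
        by_contra hlt
        rw [not_le, abs_lt] at hlt
        exact hu ⟨hlt.1, hlt.2.le⟩
  refine ⟨∫ u, (h u - q u) * u⁻¹, ?_⟩
  have h1 := tendsto_integral_mul_inv_of_integrable_div (hh.sub hqi).aestronglyMeasurable hki
  have h2 := (tendsto_integral_Ioo_inv hδ2).const_mul (h 0 : ℂ)
  have h3 := h1.add h2
  have e3 : (h 0 : ℂ) * -(Complex.I * Real.pi) = - (Complex.I * (Real.pi * h 0 : ℝ)) := by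
    push_cast; ring
  rw [e3, ← sub_eq_add_neg] at h3
  refine h3.congr' ?_
  filter_upwards [self_mem_nhdsWithin] with ε (hε : 0 < ε)
  have hcont : Continuous fun u : ℝ => ((u : ℂ) + Complex.I * ε)⁻¹ :=
    Continuous.inv₀ (by fun_prop) fun u => add_I_mul_ne_zero u hε
  have hbdd : ∀ u : ℝ, ‖((u : ℂ) + Complex.I * ε)⁻¹‖ ≤ ε⁻¹ := by
    intro u
    rw [norm_inv]
    refine inv_anti₀ hε ?_
    simpa [abs_of_pos hε] using Complex.abs_im_le_norm ((u : ℂ) + Complex.I * ε)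
  have hint : ∀ {k : ℝ → ℝ}, Integrable k →
      Integrable fun u : ℝ => (k u : ℂ) * ((u : ℂ) + Complex.I * ε)⁻¹ := fun hk =>
    hk.ofReal.mul_bdd (c := ε⁻¹) hcont.aestronglyMeasurable (Eventually.of_forall hbdd)
  have e4 : (h 0 : ℂ) * ∫ u in -(δ/2)..(δ/2), ((u : ℂ) + Complex.I * ε)⁻¹ =
      ∫ u, (q u : ℂ) * ((u : ℂ) + Complex.I * ε)⁻¹ := by
    rw [intervalIntegral.integral_of_le (by linarith), ← integral_const_mul,
      ← integral_indicator hsm]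
    refine integral_congr_ae (Eventually.of_forall fun u => ?_)
    by_cases hu : u ∈ s <;> simp [hq, hu]
  rw [e4, ← integral_add (hint (hh.sub hqi)) (hint hqi)]
  refine integral_congr_ae (Eventually.of_forall fun u => ?_)
  simp only [Pi.sub_apply]
  push_cast
  ring

/-- The Sokhotski–Plemelj formula for a density that is Hölder continuous at `-w`. -/
lemma exists_tendsto_cauchy {h : ℝ → ℝ} (hh : Integrable h) {b : ℝ} (hb : 0 < b) (w : ℝ)
    (hO : (fun u => h u - h (-w)) =O[𝓝 (-w)] fun u => |u + w| ^ b) :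
    ∃ a : ℝ, Tendsto (fun ε : ℝ => ∫ u, (h u : ℂ) * (((w + u : ℝ) : ℂ) + Complex.I * ε)⁻¹) (𝓝[>] 0)
      (𝓝 ((a : ℂ) - Complex.I * (Real.pi * h (-w) : ℝ))) := by
  have hO' : (fun u => h (u - w) - h (0 - w)) =O[𝓝 0] fun u => |u| ^ b := by
    have ht : Tendsto (fun u : ℝ => u - w) (𝓝 0) (𝓝 (-w)) := by
      have : Continuous fun u : ℝ => u - w := by fun_prop
      simpa using this.tendsto 0
    simpa [Function.comp_def] using hO.comp_tendsto ht
  obtain ⟨a, ha⟩ := exists_tendsto_cauchy_zero (hh.comp_sub_right w) hb hO'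
  refine ⟨a, ?_⟩
  rw [zero_sub] at ha
  refine ha.congr fun ε => ?_
  rw [← integral_sub_right_eq_self (fun u : ℝ => (h u : ℂ) * (((w + u : ℝ) : ℂ) + Complex.I * ε)⁻¹) w]
  simp

/-! The limits of the self-energies. -/

lemma norm_thermalFormFactor_neg_sq {β : ℝ} (hβ : 0 < β) (g : EuclideanSpace ℝ (Fin 3) → ℂ) (u : ℝ)
    (s : Sphere2) : ‖thermalFormFactor β g (-u, s)‖ ^ 2 =
      Real.exp (-β * u) * ‖thermalFormFactor β g (u, s)‖ ^ 2 := by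
  rw [thermalFormFactor_neg hβ, norm_mul, norm_neg, Complex.norm_real, RCLike.norm_conj, mul_pow,
    Real.norm_eq_abs, sq_abs, sq, ← Real.exp_add]
  ring_nf

/-- The density `h(u) = ∫_{S²} |g_β(u, Σ)|² dΣ`. -/
def Params.thermalDensity (M : Params) (u : ℝ) : ℝ :=
  ∫ s, ‖thermalFormFactor M.β M.g (u, s)‖ ^ 2 ∂sphereMeasure

/-- Detailed balance between emission and absorption, the source of the Boltzmann factor in the
invariant states. -/
lemma Params.thermalDensity_neg (M : Params) (hβ : 0 < M.β) (u : ℝ) :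
    M.thermalDensity (-u) = Real.exp (-M.β * u) * M.thermalDensity u := by
  simp only [Params.thermalDensity, norm_thermalFormFactor_neg_sq hβ]
  rw [integral_const_mul]

/-- This carries the Hölder regularity and the positivity of `J` at `Δ` over to the thermal density.
-/
lemma Params.thermalDensity_of_pos (M : Params) (hβ : 0 < M.β) {u : ℝ} (hu : 0 < u) :
    M.thermalDensity u = 2 / Real.pi * (1 - Real.exp (-M.β * u))⁻¹ * spectralDensity M.g u := by
  have hx : 0 < 1 - Real.exp (-M.β * u) := by
    rw [sub_pos, Real.exp_lt_one_iff]
    nlinarith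
  have h : ∀ s : Sphere2, ‖thermalFormFactor M.β M.g (u, s)‖ ^ 2 =
      u ^ 2 * (1 - Real.exp (-M.β * u))⁻¹ *
        ‖M.g (u • (s : EuclideanSpace ℝ (Fin 3)))‖ ^ 2 := by
    intro s
    rw [thermalFormFactor, if_pos hu.le, norm_mul, Complex.norm_real, mul_pow, Real.norm_eq_abs,
      sq_abs, mul_pow, Real.sq_sqrt (by positivity), Real.sq_sqrt (abs_nonneg _), abs_of_pos hu]
    ring
  simp only [Params.thermalDensity, h, spectralDensity]
  rw [integral_const_mul]
  have := Real.pi_pos.ne'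
  field_simp

lemma isFiniteMeasure_sphereMeasure : IsFiniteMeasure sphereMeasure := by
  unfold sphereMeasure; infer_instance

lemma Params.integrable_thermalDensity (M : Params)
    (hg : MemLp (thermalFormFactor M.β M.g) 2 modeMeasure) : Integrable M.thermalDensity := by
  have := isFiniteMeasure_sphereMeasure
  exact (hg.integrable_norm_pow (by norm_num)).integral_prod_left

/-- Fubini over the directions; for `ε > 0` the Cauchy kernel is bounded by `ε⁻¹`. -/
lemma Params.selfEnergy_one (M : Params)
    (hg : MemLp (thermalFormFactor M.β M.g) 2 modeMeasure) (ω : ℝ) {ε : ℝ} (hε : 0 < ε) :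
    M.selfEnergy 1 ω ε =
      ∫ u, (M.thermalDensity u : ℂ) * (((ω + u : ℝ) : ℂ) + Complex.I * ε)⁻¹ := by
  have := isFiniteMeasure_sphereMeasure
  have hi : Integrable (fun y : Mode => ((‖thermalFormFactor M.β M.g y‖ ^ 2 : ℝ) : ℂ) *
      (((ω + y.1 : ℝ) : ℂ) + Complex.I * ε)⁻¹) modeMeasure := by
    refine (hg.integrable_norm_pow (by norm_num)).ofReal.mul_bdd (c := ε⁻¹) ?_ ?_
    · exact (Continuous.inv₀ (by fun_prop)
        fun y : Mode => add_I_mul_ne_zero (ω + y.1) hε).aestronglyMeasurable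
    · refine Eventually.of_forall fun y => ?_
      rw [norm_inv]
      refine inv_anti₀ hε ?_
      simpa [abs_of_pos hε] using Complex.abs_im_le_norm (((ω + y.1 : ℝ) : ℂ) + Complex.I * ε)
  have h1 : M.selfEnergy 1 ω ε = ∫ y : Mode, ((‖thermalFormFactor M.β M.g y‖ ^ 2 : ℝ) : ℂ) *
      (((ω + y.1 : ℝ) : ℂ) + Complex.I * ε)⁻¹ ∂modeMeasure := by
    refine integral_congr_ae (Eventually.of_forall fun y => ?_)
    simp only [Pi.one_apply, Complex.ofReal_one, one_mul]
    push_cast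
    rw [← Complex.conj_mul']
    ring
  rw [h1, modeMeasure, integral_prod _ hi]
  refine integral_congr_ae (Eventually.of_forall fun u => ?_)
  simp only [Params.thermalDensity]
  rw [integral_mul_const, integral_complex_ofReal]

/-- Under `u ↦ -u` the weight becomes `e^{βu}` and is cancelled by the reflection of `|g_β|²`, while
the kernel becomes minus the conjugate of the kernel at frequency `-ω`. The right coupling thus
needs no separate limit. -/
lemma Params.selfEnergy_exp (M : Params) (hβ : 0 < M.β) (ω ε : ℝ) :
    M.selfEnergy (fun u => Real.exp (-M.β * u)) ω ε = -conj (M.selfEnergy 1 (-ω) ε) := by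
  simp only [Params.selfEnergy]
  rw [← integral_conj, ← integral_neg, ← integral_comp_reflect]
  refine integral_congr_ae (Eventually.of_forall fun y => ?_)
  have h1 : ((Real.exp (-M.β * -y.1) : ℝ) : ℂ) * (((Real.exp (-M.β * y.1 / 2) : ℝ) : ℂ) *
      ((Real.exp (-M.β * y.1 / 2) : ℝ) : ℂ)) = 1 := by
    rw [← Complex.ofReal_mul, ← Complex.ofReal_mul, ← Real.exp_add, ← Real.exp_add]
    norm_cast
    rw [Real.exp_eq_one_iff]
    ring
  have h2 : (((ω + -y.1 : ℝ) : ℂ) + Complex.I * ε)⁻¹ =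
      -conj ((((-ω + y.1 : ℝ) : ℂ) + Complex.I * ε)⁻¹) := by
    rw [map_inv₀, ← inv_neg]
    congr 1
    simp
    ring
  simp only [thermalFormFactor_neg hβ, h2, Pi.one_apply, Complex.ofReal_one, map_mul, map_neg,
    Complex.conj_ofReal, Complex.conj_conj, map_one]
  generalize conj (((((-ω + y.1 : ℝ) : ℂ) + Complex.I * ε)⁻¹)) = z
  linear_combination (-(thermalFormFactor M.β M.g y * z * conj (thermalFormFactor M.β M.g y))) * h1

lemma isBigO_abs_rpow_of_le {a b : ℝ} (hb : 0 ≤ b) (hab : b ≤ a) (x : ℝ) :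
    (fun u : ℝ => |u - x| ^ a) =O[𝓝 x] fun u => |u - x| ^ b := by
  refine Asymptotics.IsBigO.of_bound 1 ?_
  filter_upwards [Metric.ball_mem_nhds x one_pos] with u hu
  rw [Metric.mem_ball, Real.dist_eq] at hu
  rw [one_mul, Real.norm_of_nonneg (by positivity), Real.norm_of_nonneg (by positivity)]
  exact Real.rpow_le_rpow_of_exponent_ge' (abs_nonneg _) hu.le hb hab

/-- A differentiable multiple of a Hölder continuous function is Hölder continuous. -/
lemma isBigO_mul_sub_mul {φ k : ℝ → ℝ} {x a : ℝ} (ha : 0 < a) (hφ : DifferentiableAt ℝ φ x)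
    (hk : (fun u => k u - k x) =O[𝓝 x] fun u => |u - x| ^ a) :
    (fun u => φ u * k u - φ x * k x) =O[𝓝 x] fun u => |u - x| ^ min a 1 := by
  have h1 : (fun u => φ u * (k u - k x)) =O[𝓝 x] fun u => |u - x| ^ min a 1 := by
    have := (hφ.continuousAt.isBigO_one ℝ).mul
      (hk.trans (isBigO_abs_rpow_of_le (le_min ha.le zero_le_one) (min_le_left a 1) x))
    simpa using this
  have h2 : (fun u => (φ u - φ x) * k x) =O[𝓝 x] fun u => |u - x| ^ min a 1 := by
    have h3 : (fun u => φ u - φ x) =O[𝓝 x] fun u => |u - x| ^ (1 : ℝ) := by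
      simpa using hφ.isBigO_sub.norm_right
    have := (h3.trans (isBigO_abs_rpow_of_le (le_min ha.le zero_le_one) (min_le_right a 1) x)).const_mul_left (k x)
    simpa [mul_comm] using this
  refine (h1.add h2).congr_left fun u => ?_
  ring

/-- The limits of the self-energies at the Bohr frequencies. -/
lemma Params.exists_tendsto_selfEnergy (M : Params) (hgap : 0 < M.gap) (hβ : 0 < M.β)
    (hg : MemLp (thermalFormFactor M.β M.g) 2 modeMeasure)
    (hreg : ∃ a : ℝ, 0 < a ∧ (fun ω => spectralDensity M.g ω - spectralDensity M.g M.gap)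
        =O[𝓝 M.gap] fun ω => |ω - M.gap| ^ a)
    (hJ : 0 < spectralDensity M.g M.gap) :
    ∃ s r c : ℝ, 0 < c ∧
      Tendsto (M.selfEnergy 1 M.gap) (𝓝[>] 0) (𝓝 ((s : ℂ) - Complex.I * c)) ∧
      Tendsto (M.selfEnergy 1 (-M.gap)) (𝓝[>] 0)
        (𝓝 ((r : ℂ) - Complex.I * (Real.exp (M.β * M.gap) * c : ℝ))) := by
  obtain ⟨a, ha, hO⟩ := hreg
  set φ : ℝ → ℝ := fun u => 2 / Real.pi * (1 - Real.exp (-M.β * u))⁻¹ with hφ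
  have hx : 0 < 1 - Real.exp (-M.β * M.gap) := by
    rw [sub_pos, Real.exp_lt_one_iff]
    nlinarith
  have hφd : DifferentiableAt ℝ φ M.gap := by
    refine DifferentiableAt.const_mul (DifferentiableAt.inv (h := fun u => 1 - Real.exp (-M.β * u))
      (by fun_prop) hx.ne') _
  have hpos : 0 < M.thermalDensity M.gap := by
    rw [M.thermalDensity_of_pos hβ hgap]
    positivity
  have hb : 0 < min a 1 := lt_min ha one_pos
  have h1 : (fun u => M.thermalDensity u - M.thermalDensity M.gap) =O[𝓝 M.gap]
      fun u => |u - M.gap| ^ min a 1 := by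
    refine (isBigO_mul_sub_mul ha hφd hO).congr' ?_ EventuallyEq.rfl
    filter_upwards [lt_mem_nhds hgap] with u hu
    rw [M.thermalDensity_of_pos hβ hu, M.thermalDensity_of_pos hβ hgap]
  have h2 : (fun u => M.thermalDensity u - M.thermalDensity (-M.gap)) =O[𝓝 (-M.gap)]
      fun u => |u + M.gap| ^ min a 1 := by
    have ht : Tendsto (fun u : ℝ => -u) (𝓝 (-M.gap)) (𝓝 M.gap) := by
      simpa using (continuous_neg.tendsto (-M.gap))
    have h3 : (fun u => M.thermalDensity (-u) - M.thermalDensity (- -M.gap)) =O[𝓝 (-M.gap)]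
        fun u => |u - -M.gap| ^ min a 1 := by
      rw [neg_neg]
      refine (h1.comp_tendsto ht).congr_right fun u => ?_
      simp only [Function.comp]
      rw [← abs_neg]
      ring_nf
    -- Regularity at `-Δ` comes from that at `Δ` through `h(u) = e^{βu} h(-u)`. The smooth factor
    -- costs nothing, since the exponent is already at most `1`.
    have h4 := isBigO_mul_sub_mul hb (φ := fun u => Real.exp (M.β * u)) (by fun_prop) h3
    have h5 : min (min a 1) 1 = min a 1 := min_eq_left (min_le_right a 1)
    rw [h5] at h4
    have h6 : ∀ u, Real.exp (M.β * u) * M.thermalDensity (-u) = M.thermalDensity u := by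
      intro u
      rw [M.thermalDensity_neg hβ, ← mul_assoc, ← Real.exp_add]
      simp
    simpa only [h6, sub_neg_eq_add] using h4
  have hi := M.integrable_thermalDensity hg
  -- The kernel at frequency `Δ` has its pole at `u = -Δ`, hence the constant `c = π h(-Δ)`.
  obtain ⟨s, hs⟩ := exists_tendsto_cauchy hi hb M.gap h2
  obtain ⟨r, hr⟩ := exists_tendsto_cauchy hi hb (-M.gap) (by simpa [← sub_eq_add_neg] using h1)
  have h7 : M.thermalDensity (- -M.gap) =
      Real.exp (M.β * M.gap) * M.thermalDensity (-M.gap) := by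
    rw [M.thermalDensity_neg hβ]
    simp
  refine ⟨s, r, Real.pi * M.thermalDensity (-M.gap), ?_, ?_, ?_⟩
  · rw [M.thermalDensity_neg hβ]
    positivity
  · refine hs.congr' ?_
    filter_upwards [self_mem_nhdsWithin] with ε hε
    rw [M.selfEnergy_one hg _ hε]
  · rw [h7] at hr
    rw [mul_left_comm]
    refine hr.congr' ?_
    filter_upwards [self_mem_nhdsWithin] with ε hε
    rw [M.selfEnergy_one hg _ hε]

/-! The level shift operators. -/

/-- The operator `⊕_e Λ_e` for self-energies `A` and `B` of the left and right couplings. -/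
def Params.shiftMatrix (M : Params) (lam : ℝ) (A B : Fin 3 → Fin 3 → ℂ) (e : ℝ) :
    Matrix (Fin 3 × Fin 3) (Fin 3 × Fin 3) ℂ :=
  Matrix.of fun a b =>
    if M.energy 0 a.1 - M.energy 0 a.2 = e ∧ M.energy 0 b.1 - M.energy 0 b.2 = e then
      (if a = b then (e : ℂ) else 0) - lam ^ 2 / 2 * shiftEntry A B a b
    else 0

/-- The value `x` at the excited level, `y` at the ground levels. -/
def levelValue (x y : ℂ) (l : Fin 3) : ℂ := if l = 0 then x else y

lemma Params.tendsto_regLevelShift (M : Params) (hβ : 0 < M.β) (lam e : ℝ) {x y : ℂ}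
    (hx : Tendsto (M.selfEnergy 1 M.gap) (𝓝[>] 0) (𝓝 x))
    (hy : Tendsto (M.selfEnergy 1 (-M.gap)) (𝓝[>] 0) (𝓝 y)) :
    Tendsto (M.regLevelShift 0 lam e) (𝓝[>] 0) (𝓝 (M.shiftMatrix lam
      (fun l _ => levelValue x y l) (fun l _ => levelValue (-conj y) (-conj x) l) e)) := by
  have hB : ∀ ω : ℝ, ∀ z : ℂ, Tendsto (M.selfEnergy 1 (-ω)) (𝓝[>] 0) (𝓝 z) →
      Tendsto (M.selfEnergy (fun u => Real.exp (-M.β * u)) ω) (𝓝[>] 0) (𝓝 (-conj z)) := by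
    intro ω z hz
    exact (((Complex.continuous_conj.tendsto z).comp hz).neg).congr
      fun ε => (M.selfEnergy_exp hβ ω ε).symm
  have hA' : ∀ l m : Fin 3, Tendsto
      (fun ε => coupling m l * M.selfEnergy 1 (M.energy 0 l - M.energy 0 m) ε) (𝓝[>] 0)
      (𝓝 (coupling m l * levelValue x y l)) := by
    -- The coupling coefficient must stay in the product: where it vanishes the frequency is `0`,
    -- and no limit of the self-energy is available there. Where it does not, the frequency depends
    -- on `l` alone.
    intro l m
    by_cases h : coupling m l = 0
    · simp [h]
    refine Tendsto.const_mul _ ?_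
    fin_cases l <;> fin_cases m <;> simp [coupling] at h <;>
      simp [Params.energy, levelValue] <;> first | simpa [Params.gap] using hx | simpa [Params.gap] using hy
  have hB' : ∀ l m : Fin 3, Tendsto (fun ε => coupling l m *
      M.selfEnergy (fun u => Real.exp (-M.β * u)) (M.energy 0 l - M.energy 0 m) ε) (𝓝[>] 0)
      (𝓝 (coupling l m * levelValue (-conj y) (-conj x) l)) := by
    intro l m
    by_cases h : coupling l m = 0
    · simp [h]
    refine Tendsto.const_mul _ ?_
    have h1 := hB M.gap y hy
    have h2 := hB (-M.gap) x (by simpa using hx)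
    fin_cases l <;> fin_cases m <;> simp [coupling] at h <;>
      simp [Params.energy, levelValue] <;> first | simpa [Params.gap] using h1 | simpa [Params.gap] using h2
  refine tendsto_pi_nhds.2 fun a => tendsto_pi_nhds.2 fun b => ?_
  simp only [M.regLevelShift_apply hβ, Params.shiftMatrix, Matrix.of_apply]
  by_cases hab : M.energy 0 a.1 - M.energy 0 a.2 = e ∧ M.energy 0 b.1 - M.energy 0 b.2 = e
  · simp only [if_pos hab]
    refine Tendsto.const_sub _ (Tendsto.const_mul _ (Tendsto.sub ?_ ?_))
    · exact tendsto_finsetSum _ fun l _ => (hA' l a.1).mul_const _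
    · exact tendsto_finsetSum _ fun l _ => (hB' a.2 l).mul_const _
  · simp only [if_neg hab]
    exact tendsto_const_nhds

lemma Params.levelShift_eq (M : Params) (hβ : 0 < M.β) (lam e : ℝ) {x y : ℂ}
    (hx : Tendsto (M.selfEnergy 1 M.gap) (𝓝[>] 0) (𝓝 x))
    (hy : Tendsto (M.selfEnergy 1 (-M.gap)) (𝓝[>] 0) (𝓝 y)) :
    M.levelShift 0 lam e = M.shiftMatrix lam
      (fun l _ => levelValue x y l) (fun l _ => levelValue (-conj y) (-conj x) l) e :=
  (M.tendsto_regLevelShift hβ lam e hx hy).limUnder_eq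

/-! Invariance under the approximate dynamics. -/

/-- The derivative at `0` is `R * X`; conversely, if `R * X = 0`, the derivative vanishes at every
time. -/
lemma mul_exp_smul_eq_self_iff {𝔸 : Type*} [NormedRing 𝔸] [NormedAlgebra ℝ 𝔸] [CompleteSpace 𝔸]
    (R X : 𝔸) : (∀ t : ℝ, 0 ≤ t → R * NormedSpace.exp (t • X) = R) ↔ R * X = 0 := by
  have hd : ∀ t : ℝ, HasDerivAt (fun t : ℝ => R * NormedSpace.exp (t • X))
      (R * (X * NormedSpace.exp (t • X))) t := fun t =>
    (hasDerivAt_exp_smul_const' X t).const_mul R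
  constructor
  · intro h
    have h1 := (hd 0).hasDerivWithinAt (s := Set.Ici 0)
    have h2 : HasDerivWithinAt (fun t : ℝ => R * NormedSpace.exp (t • X)) 0 (Set.Ici 0) 0 :=
      (hasDerivWithinAt_const (0 : ℝ) (Set.Ici 0) R).congr (fun t ht => h t ht) (h 0 le_rfl)
    have h3 := (uniqueDiffWithinAt_Ici (0 : ℝ)).eq_deriv _ h1 h2
    simpa using h3
  · intro h t _
    have h1 := is_const_of_deriv_eq_zero (fun t => (hd t).differentiableAt)
      (fun t => by rw [(hd t).deriv, ← mul_assoc, h, zero_mul]) t 0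
    simpa using h1

lemma vecMul_exp_eq_self_iff {κ : Type*} [Fintype κ] [DecidableEq κ] (v : κ → ℂ)
    (X : Matrix κ κ ℂ) :
    (∀ t : ℝ, 0 ≤ t → v ᵥ* NormedSpace.exp ((Complex.I * t) • X) = v) ↔ v ᵥ* X = 0 := by
  rcases isEmpty_or_nonempty κ with hκ | ⟨⟨k⟩⟩
  · exact ⟨fun _ => Subsingleton.elim _ _, fun _ _ _ => Subsingleton.elim _ _⟩
  let : NormedRing (Matrix κ κ ℂ) := Matrix.linftyOpNormedRing
  let : NormedAlgebra ℝ (Matrix κ κ ℂ) := Matrix.linftyOpNormedAlgebra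
  -- The row vector is replaced by the square matrix all of whose rows equal it, so that the
  -- statement lives in a Banach algebra.
  have key := mul_exp_smul_eq_self_iff (Matrix.of fun _ => v : Matrix κ κ ℂ) (Complex.I • X)
  have hrow : ∀ N N' : Matrix κ κ ℂ, (Matrix.of fun _ => v : Matrix κ κ ℂ) * N =
      Matrix.of (fun _ => v ᵥ* N) := fun N _ => rfl
  have hof : ∀ w w' : κ → ℂ, (Matrix.of fun _ => w : Matrix κ κ ℂ) = Matrix.of (fun _ => w') ↔
      w = w' := fun w w' => ⟨fun h => congrFun h k, fun h => by rw [h]⟩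
  have hz : (0 : Matrix κ κ ℂ) = Matrix.of (fun _ => (0 : κ → ℂ)) := rfl
  have hs : ∀ t : ℝ, (Complex.I * t) • X = t • Complex.I • X := by
    intro t
    rw [mul_comm, mul_smul]
    ext i j
    simp
  simp only [hs]
  rw [hz] at key
  simp only [hrow _ 0, hof, Matrix.vecMul_smul] at key ⊢
  refine Iff.trans key ?_
  simp [Complex.I_ne_zero]

/-- The factor `√3` in `b` cancels the normalisation of `ψ_ref`, and the trace pairing with
observables makes `U(t)` act from the right on the transpose of `ρ`. -/
lemma Params.approxDynamics_zero_apply (M : Params) (lam t : ℝ) {ρ : Matrix (Fin 3) (Fin 3) ℂ}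
    (hρ : ρ.PosSemidef) (k l : Fin 3) : M.approxDynamics 0 lam t ρ k l =
      ((fun a : Fin 3 × Fin 3 => ρ a.2 a.1) ᵥ* M.evolution 0 lam t) (l, k) := by
  have hZ : M.partition 0 ≠ 0 := (Finset.sum_pos (fun j _ => Real.exp_pos _) (by simp)).ne'
  have hX : M.correction 0 = 1 := by
    have : (![1, 1, 1] : Fin 3 → ℂ) = 1 := by
      funext i; fin_cases i <;> rfl
    simp [Params.correction, div_self hZ, this]
  have h3 : ((Real.sqrt 3 : ℝ) : ℂ) ≠ 0 := by
    exact_mod_cast (Real.sqrt_pos.mpr (by norm_num : (0 : ℝ) < 3)).ne'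
  rw [Params.approxDynamics, Matrix.of_apply,
    M.resonanceFunctional_eq 0 lam t (represents_stateVector hρ), hX, one_mul, mul_one]
  have hv : leftAct (Matrix.single l k 1) refVector =
      ((Real.sqrt 3 : ℝ) : ℂ)⁻¹ • (Pi.single (l, k) 1 : Pair) := by
    funext ⟨i, j⟩
    simp only [leftAct, refVector, Matrix.single_apply, Pi.smul_apply, smul_eq_mul, Pi.single_apply,
      Prod.mk.injEq, ite_and, ite_mul, one_mul, zero_mul]
    rcases eq_or_ne i l with rfl | hi <;> rcases eq_or_ne j k with rfl | hj <;>
      simp [*, Ne.symm]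
  rw [hv, Matrix.mulVec_smul]
  simp only [Matrix.mulVec_single_one, Pi.smul_apply, smul_eq_mul, Matrix.vecMul, dotProduct,
    Fintype.sum_prod_type, Finset.mul_sum, Matrix.col_apply]
  refine Finset.sum_congr rfl fun i _ => Finset.sum_congr rfl fun j _ => ?_
  field_simp

lemma Params.approxDynamics_invariant_iff (M : Params) (lam : ℝ) {ρ : Matrix (Fin 3) (Fin 3) ℂ}
    (hρ : ρ.PosSemidef) : (∀ t : ℝ, 0 ≤ t → M.approxDynamics 0 lam t ρ = ρ) ↔
      (fun a : Fin 3 × Fin 3 => ρ a.2 a.1) ᵥ* M.totalLevelShift 0 lam = 0 := by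
  rw [← vecMul_exp_eq_self_iff]
  refine forall₂_congr fun t _ => ⟨fun h => ?_, fun h => ?_⟩
  · funext ⟨l, k⟩
    rw [← Params.evolution, ← M.approxDynamics_zero_apply lam t hρ, h]
  · ext k l
    rw [M.approxDynamics_zero_apply lam t hρ, Params.evolution, h]

/-! ### Block structure and joint kernel of the level shift operators. -/

/-- The Bohr frequency of `φ_j ⊗ φ_k` in units of the gap. -/
def bohrIndex (a : Fin 3 × Fin 3) : ℤ := (if a.1 = 0 then 1 else 0) - (if a.2 = 0 then 1 else 0)

lemma Params.energy_sub_eq (M : Params) (a : Fin 3 × Fin 3) :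
    M.energy 0 a.1 - M.energy 0 a.2 = bohrIndex a * M.gap := by
  obtain ⟨i, j⟩ := a
  fin_cases i <;> fin_cases j <;> simp [Params.energy, Params.gap, bohrIndex]

/-- Since the gap is nonzero, `0`, `Δ` and `-Δ` are distinct and at most one of the three summands
contributes to each entry. -/
lemma Params.sum_shiftMatrix_apply (M : Params) (hgap : 0 < M.gap) (lam : ℝ)
    (A B : Fin 3 → Fin 3 → ℂ) (a b : Fin 3 × Fin 3) :
    (M.shiftMatrix lam A B 0 + M.shiftMatrix lam A B M.gap + M.shiftMatrix lam A B (-M.gap)) a b =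
      if bohrIndex a = bohrIndex b then
        (if a = b then (bohrIndex a : ℂ) * M.gap else 0) - lam ^ 2 / 2 * shiftEntry A B a b
      else 0 := by
  have h0 : ∀ n : ℤ, (n : ℝ) * M.gap = 0 ↔ n = 0 := by
    intro n; simp [hgap.ne']
  have h1 : ∀ n : ℤ, (n : ℝ) * M.gap = M.gap ↔ n = 1 := by
    intro n; rw [mul_eq_right₀ hgap.ne']; norm_cast
  have h2 : ∀ n : ℤ, (n : ℝ) * M.gap = -M.gap ↔ n = -1 := by
    intro n; rw [← neg_one_mul, mul_left_inj' hgap.ne']; norm_cast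
  have hr : ∀ a : Fin 3 × Fin 3, bohrIndex a = 0 ∨ bohrIndex a = 1 ∨ bohrIndex a = -1 := by decide
  simp only [Matrix.add_apply, Params.shiftMatrix, Matrix.of_apply, M.energy_sub_eq, h0, h1, h2]
  rcases hr a with ha | ha | ha <;> rcases hr b with hb | hb | hb <;> simp [ha, hb]

/-- The system has eigenvectors `(1, ±1)` with eigenvalues `u ± v`. -/
lemma eq_zero_of_symmetric_system {u v p q : ℂ} (h1 : u + v ≠ 0) (h2 : u - v ≠ 0)
    (e1 : p * u + q * v = 0) (e2 : p * v + q * u = 0) : p = 0 ∧ q = 0 := by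
  have hs : p + q = 0 := by
    refine (mul_eq_zero.1 (?_ : (p + q) * (u + v) = 0)).resolve_right h1
    linear_combination e1 + e2
  have hm : p - q = 0 := by
    refine (mul_eq_zero.1 (?_ : (p - q) * (u - v) = 0)).resolve_right h2
    linear_combination e1 - e2
  constructor
  · linear_combination hs / 2 + hm / 2
  · linear_combination hs / 2 - hm / 2

/-- The joint kernel of the transposed level shift operators. -/
lemma vecMul_shift_eq_zero_iff {gap lam s r c d : ℝ} {T : Matrix (Fin 3 × Fin 3) (Fin 3 × Fin 3) ℂ}
    (hlam : lam ≠ 0) (hc : 0 < c) (hd : 0 < d) {x y : ℂ}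
    (hx : x = s - Complex.I * c) (hy : y = r - Complex.I * d)
    (hT : ∀ a b, T a b = if bohrIndex a = bohrIndex b then
        (if a = b then (bohrIndex a : ℂ) * gap else 0) - lam ^ 2 / 2 *
          shiftEntry (fun l _ => levelValue x y l) (fun l _ => levelValue (-conj y) (-conj x) l) a b
      else 0) (ρ : Matrix (Fin 3) (Fin 3) ℂ) :
    (fun a : Fin 3 × Fin 3 => ρ a.2 a.1) ᵥ* T = 0 ↔
      ρ 0 1 = 0 ∧ ρ 0 2 = 0 ∧ ρ 1 0 = 0 ∧ ρ 2 0 = 0 ∧ ρ 1 1 = ρ 2 2 ∧ ρ 1 2 = ρ 2 1 ∧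
        c * (ρ 1 1 + ρ 1 2) = d * ρ 0 0 := by
  have hcx : conj x = s + Complex.I * c := by
    rw [hx]; simp
  have hcy : conj y = r + Complex.I * d := by
    rw [hy]; simp
  rw [funext_iff, Prod.forall]
  simp only [Fin.forall_fin_succ, Matrix.vecMul, dotProduct,
    Fintype.sum_prod_type, Fin.sum_univ_three, hT]
  simp [bohrIndex, shiftEntry, commutatorEntry, coupling, levelValue, hcx, hcy, Fin.sum_univ_three]
  obtain ⟨κ, hκ⟩ : ∃ κ : ℝ, κ = lam ^ 2 / 2 := ⟨_, rfl⟩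
  have hκc : (lam : ℂ) ^ 2 / 2 = κ := by rw [hκ]; push_cast; rfl
  have hκ0 : 0 < κ := by rw [hκ]; positivity
  have hκ1 : (κ : ℂ) ≠ 0 := by exact_mod_cast hκ0.ne'
  have hdκ : 0 < κ * d := by positivity
  have hcκ : 0 < κ * c := by positivity
  rw [hκc]
  constructor
  -- The population equation of the excited level is dropped, being a consequence of the others.
  -- `c1`, `c2` form the block `Δ`; `r1`, `r2` form the block `-Δ`.
  · rintro ⟨⟨-, c1, c2⟩, ⟨r1, e11, e12⟩, r2, e21, e22⟩
    have hne : ∀ {z : ℂ}, z.im ≠ 0 → z ≠ 0 := fun h hz => h (by rw [hz]; rfl)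
    -- The eigenvalues have imaginary parts `2κ(c + d)` and `2κd`, the decay rates of the symmetric
    -- and antisymmetric coherences; the other block has the same rates.
    obtain ⟨h10, h20⟩ := eq_zero_of_symmetric_system
      (p := ρ 1 0) (q := ρ 2 0) (u := gap - κ * (y + y - (s + Complex.I * c)))
      (v := κ * (s + Complex.I * c))
      (hne (by simp [hy]; nlinarith)) (hne (by simp [hy]; nlinarith))
      (by linear_combination c1) (by linear_combination c2)
    obtain ⟨h01, h02⟩ := eq_zero_of_symmetric_system
      (p := ρ 0 1) (q := ρ 0 2)
      (u := -gap - κ * (x - (r + Complex.I * d + (r + Complex.I * d)))) (v := -(κ * x))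
      (hne (by simp [hx]; nlinarith)) (hne (by simp [hx]; nlinarith))
      (by linear_combination r1) (by linear_combination r2)
    have hx0 : x ≠ 0 := hne (by simp [hx, hc.ne'])
    have hX0 : (s + Complex.I * c : ℂ) ≠ 0 := hne (by simp [hc.ne'])
    -- Differences of the ground-level equations eliminate `ρ 0 0` and leave a nonzero multiple of
    -- `x`, or of its conjugate, times a difference of row or column sums.
    have hR : ρ 1 1 + ρ 1 2 - (ρ 2 1 + ρ 2 2) = 0 := by
      refine (mul_eq_zero.1 (?_ : κ * x * _ = 0)).resolve_left (mul_ne_zero hκ1 hx0)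
      linear_combination e12 - e11
    have hC : ρ 1 1 + ρ 2 1 - (ρ 1 2 + ρ 2 2) = 0 := by
      refine (mul_eq_zero.1 (?_ : κ * (s + Complex.I * c : ℂ) * _ = 0)).resolve_left
        (mul_ne_zero hκ1 hX0)
      linear_combination e11 - e21
    have h12 : ρ 1 2 = ρ 2 1 := by linear_combination hR / 2 - hC / 2
    refine ⟨h01, h02, h10, h20, by linear_combination hR / 2 + hC / 2, h12, ?_⟩
    -- With `ρ 1 2 = ρ 2 1` the real parts `s` and `r` cancel, and only the rate balance remains.
    have h2 : κ * (2 * Complex.I) * (c * (ρ 1 1 + ρ 1 2) - d * ρ 0 0) = 0 := by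
      rw [hx, hy] at e11
      linear_combination e11 + κ * (s + Complex.I * c) * h12
    exact sub_eq_zero.1 ((mul_eq_zero.1 h2).resolve_left (by simp [hκ1]))
  · rintro ⟨h01, h02, h10, h20, h11, h12, h⟩
    rw [h01, h02, h10, h20, ← h11, ← h12, hx, hy]
    refine ⟨⟨?_, ?_, ?_⟩, ⟨?_, ?_, ?_⟩, ?_, ?_, ?_⟩
    · linear_combination -4 * κ * Complex.I * h
    · ring
    · ring
    · ring
    · linear_combination 2 * κ * Complex.I * h
    · linear_combination 2 * κ * Complex.I * h
    · ring
    · linear_combination 2 * κ * Complex.I * h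
    · linear_combination 2 * κ * Complex.I * h


/-- Only the ratio `d / c = e^{βΔ}` of the two rates survives; the energy shifts `s`, `r` and the
coupling strength drop out. -/
lemma Params.invariant_iff (M : Params) {lam : ℝ} (hgap : 0 < M.gap) (hβ : 0 < M.β)
    (hlam : lam ≠ 0) {s r c : ℝ} (hc : 0 < c)
    (hx : Tendsto (M.selfEnergy 1 M.gap) (𝓝[>] 0) (𝓝 ((s : ℂ) - Complex.I * c)))
    (hy : Tendsto (M.selfEnergy 1 (-M.gap)) (𝓝[>] 0)
        (𝓝 ((r : ℂ) - Complex.I * (Real.exp (M.β * M.gap) * c : ℝ))))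
    {ρ : Matrix (Fin 3) (Fin 3) ℂ} (hρ : ρ.PosSemidef) :
    (∀ t : ℝ, 0 ≤ t → M.approxDynamics 0 lam t ρ = ρ) ↔
      ρ 0 1 = 0 ∧ ρ 0 2 = 0 ∧ ρ 1 0 = 0 ∧ ρ 2 0 = 0 ∧ ρ 1 1 = ρ 2 2 ∧ ρ 1 2 = ρ 2 1 ∧
        ρ 1 1 + ρ 1 2 = (Real.exp (M.β * M.gap) : ℝ) * ρ 0 0 := by
  have hc' : (c : ℂ) ≠ 0 := by exact_mod_cast hc.ne'
  rw [M.approxDynamics_invariant_iff lam hρ, vecMul_shift_eq_zero_iff hlam hc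
    (by positivity : 0 < Real.exp (M.β * M.gap) * c) rfl rfl
    (fun a b => by
      rw [Params.totalLevelShift, M.levelShift_eq hβ lam 0 hx hy,
        M.levelShift_eq hβ lam M.gap hx hy, M.levelShift_eq hβ lam (-M.gap) hx hy]
      exact M.sum_shiftMatrix_apply hgap lam _ _ a b) ρ]
  have h : (c : ℂ) * (ρ 1 1 + ρ 1 2) = (Real.exp (M.β * M.gap) * c : ℝ) * ρ 0 0 ↔
      ρ 1 1 + ρ 1 2 = (Real.exp (M.β * M.gap) : ℝ) * ρ 0 0 := by
    rw [Complex.ofReal_mul, mul_comm _ (c : ℂ), mul_assoc, mul_right_inj' hc']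
  rw [h]

/-! ### Positivity, and the mixtures of the Gibbs state with the dark state. -/

/-- The state with occupation `p` of the excited level and coherence `α` of the ground levels. -/
def invariantState (p α : ℝ) : Matrix (Fin 3) (Fin 3) ℂ :=
  !![(p : ℂ), 0, 0; 0, (1 - p) / 2, α; 0, α, (1 - p) / 2]

/-- Spectral decomposition along `(1,0,0)`, `(0,1,1)`, `(0,1,-1)` with eigenvalues `p`, `(1-p)/2 +
α`, `(1-p)/2 - α`; the last two are halved because the vectors have squared norm `2`. -/
lemma posSemidef_invariantState {p α : ℝ} (hp : 0 ≤ p) (h1 : 2 * α ≤ 1 - p)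
    (h2 : -(2 * α) ≤ 1 - p) : (invariantState p α).PosSemidef := by
  have h := ((Matrix.posSemidef_vecMulVec_self_star (![1, 0, 0] : Fin 3 → ℂ)).smul
    (Complex.zero_le_real.2 hp)).add (((Matrix.posSemidef_vecMulVec_self_star
      (![0, 1, 1] : Fin 3 → ℂ)).smul (Complex.zero_le_real.2
        (by linarith : 0 ≤ ((1 - p) / 2 + α) / 2))).add
      ((Matrix.posSemidef_vecMulVec_self_star (![0, 1, -1] : Fin 3 → ℂ)).smul
        (Complex.zero_le_real.2 (by linarith : 0 ≤ ((1 - p) / 2 - α) / 2))))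
  convert h using 1
  ext i j
  simp only [Matrix.add_apply, Matrix.smul_apply, Matrix.vecMulVec_apply, Pi.star_apply]
  fin_cases i <;> fin_cases j <;> simp [invariantState] <;> ring

lemma trace_invariantState (p α : ℝ) : (invariantState p α).trace = 1 := by
  simp [invariantState, Matrix.trace, Fin.sum_univ_three]
  ring

/-- The density matrices in the joint kernel of the transposed level shift operators. -/
lemma density_kernel_iff {x : ℝ} (hx : 0 < x) (ρ : Matrix (Fin 3) (Fin 3) ℂ) :
    (IsDensityMatrix ρ ∧ (ρ 0 1 = 0 ∧ ρ 0 2 = 0 ∧ ρ 1 0 = 0 ∧ ρ 2 0 = 0 ∧ ρ 1 1 = ρ 2 2 ∧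
      ρ 1 2 = ρ 2 1 ∧ ρ 1 1 + ρ 1 2 = x * ρ 0 0)) ↔
    ∃ p α : ℝ, p ∈ Set.Icc 0 (x + 1)⁻¹ ∧ α = ((2 * x + 1) * p - 1) / 2 ∧
      ρ = invariantState p α := by
  have hx1 : 0 < x + 1 := by positivity
  constructor
  · rintro ⟨⟨hρ, htr⟩, h01, h02, h10, h20, h11, h12, h⟩
    have h00 : 0 ≤ ρ 0 0 := hρ.diag_nonneg
    obtain ⟨p, hp⟩ : ∃ p : ℝ, ρ 0 0 = p := ⟨_, (Complex.eq_re_of_ofReal_le (r := 0) (by simpa using h00))⟩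
    have hp0 : 0 ≤ p := by rw [hp] at h00; exact_mod_cast h00
    have ht : ρ 0 0 + ρ 1 1 + ρ 2 2 = 1 := by
      rw [← htr]; simp [Matrix.trace, Fin.sum_univ_three]
    have e1 : ρ 1 1 = (1 - p) / 2 := by
      rw [hp, ← h11] at ht
      linear_combination ht / 2
    have e2 : ρ 1 2 = (((2 * x + 1) * p - 1) / 2 : ℝ) := by
      push_cast
      rw [e1, hp] at h
      linear_combination h
    -- Testing positivity on the dark direction gives `(x + 1) p ≤ 1`, the upper end of the
    -- interval.
    have hτ := hρ.dotProduct_mulVec_nonneg ![0, 1, -1]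
    have hτ' : star (![0, 1, -1] : Fin 3 → ℂ) ⬝ᵥ ρ *ᵥ ![0, 1, -1] =
        ((2 - 2 * ((x + 1) * p) : ℝ) : ℂ) := by
      simp [dotProduct, Matrix.mulVec, Fin.sum_univ_three]
      rw [← h11, ← h12, e1, e2]
      push_cast
      ring
    rw [hτ', Complex.zero_le_real] at hτ
    refine ⟨p, _, ⟨hp0, ?_⟩, rfl, ?_⟩
    · rw [← one_div, le_div_iff₀ hx1]
      linarith
    · ext i j
      fin_cases i <;> fin_cases j <;>
        simp [invariantState, hp, h01, h02, h10, h20, ← h11, ← h12, e1, e2]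
  · rintro ⟨p, α, ⟨hp0, hp1⟩, hα, rfl⟩
    rw [← one_div, le_div_iff₀ hx1] at hp1
    -- In the symmetric direction `(0,1,1)` positivity amounts to `2xp ≥ 0` and imposes nothing new.
    have hpx : 0 ≤ x * p := by positivity
    refine ⟨⟨posSemidef_invariantState hp0 (by linarith) (by linarith),
      trace_invariantState p α⟩, ?_⟩
    simp [invariantState, hα]
    ring

/-- The factor `e^{-βE₀}` is pulled out of the exponential and cancels in the normalisation. -/
lemma Params.gibbs_zero (M : Params) : M.gibbs 0 =
    ((1 + 2 * Real.exp (M.β * M.gap) : ℝ) : ℂ)⁻¹ • Matrix.diagonal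
      ![1, (Real.exp (M.β * M.gap) : ℂ), (Real.exp (M.β * M.gap) : ℂ)] := by
  have h1 : NormedSpace.exp ((-M.β : ℂ) • M.hamiltonian 0) =
      (Real.exp (-M.β * M.E₀) : ℂ) • Matrix.diagonal
      ![1, (Real.exp (M.β * M.gap) : ℂ), (Real.exp (M.β * M.gap) : ℂ)] := by
    have h2 : Real.exp (-M.β * M.E₀) * Real.exp (M.β * M.gap) = Real.exp (-M.β * M.E) := by
      rw [← Real.exp_add, Params.gap]; ring_nf
    rw [Params.hamiltonian, ← Matrix.diagonal_smul, Matrix.exp_diagonal, ← Matrix.diagonal_smul]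
    congr 1
    funext i
    rw [Pi.exp_def, ← Complex.exp_eq_exp_ℂ]
    fin_cases i
    · simp [Params.energy]
    all_goals
      simp only [Pi.smul_apply, smul_eq_mul, Params.energy]
      simp
      rw [neg_mul, neg_mul] at h2
      exact_mod_cast h2.symm
  have h3 : ((Real.exp (-M.β * M.E₀) : ℝ) : ℂ) ≠ 0 := by exact_mod_cast (Real.exp_pos _).ne'
  rw [Params.gibbs, h1, Matrix.trace_smul, Matrix.trace_diagonal, smul_smul]
  congr 1
  simp only [Fin.sum_univ_three, Matrix.cons_val_zero, Matrix.cons_val_one, Matrix.cons_val,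
    smul_eq_mul]
  rw [mul_inv, mul_comm, ← mul_assoc, mul_inv_cancel₀ h3, one_mul]
  push_cast
  ring

lemma darkState_eq : darkState = !![0, 0, 0; 0, 1 / 2, -(1 / 2); 0, -(1 / 2), 1 / 2] := by
  have h2 : ((Real.sqrt 2 : ℝ) : ℂ)⁻¹ * ((Real.sqrt 2 : ℝ) : ℂ)⁻¹ = 1 / 2 := by
    rw [← mul_inv, ← Complex.ofReal_mul, Real.mul_self_sqrt (by norm_num)]
    norm_num
  have hs : star (((Real.sqrt 2 : ℝ) : ℂ)⁻¹) = ((Real.sqrt 2 : ℝ) : ℂ)⁻¹ := by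
    rw [star_inv₀, Complex.star_def, Complex.conj_ofReal]
  unfold darkState darkVector
  generalize ((Real.sqrt 2 : ℝ) : ℂ)⁻¹ = w at h2 hs
  rw [Complex.star_def] at hs
  ext i j
  simp only [Matrix.vecMulVec_apply, Pi.star_apply, Pi.smul_apply]
  fin_cases i <;> fin_cases j <;> simp [hs, h2]

lemma Params.mixture_eq_invariantState (M : Params) (μ : ℝ) :
    (μ : ℂ) • M.gibbs 0 + (1 - μ : ℂ) • darkState =
      invariantState (μ / (1 + 2 * Real.exp (M.β * M.gap))) ((μ - 1) / 2) := by
  have hne : (1 + 2 * (Real.exp (M.β * M.gap) : ℝ) : ℂ) ≠ 0 := by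
    exact_mod_cast (by positivity : 1 + 2 * Real.exp (M.β * M.gap) ≠ 0)
  rw [M.gibbs_zero, darkState_eq]
  generalize Real.exp (M.β * M.gap) = X at *
  ext i j
  simp only [Matrix.add_apply, Matrix.smul_apply]
  fin_cases i <;> fin_cases j <;> simp [invariantState] <;> field_simp <;> ring

end ThreeLevel

end

theorem proposition3 (M : ThreeLevel.Params) (lam : ℝ) (hgap : 0 < M.gap) (hβ : 0 < M.β)
    (hlam : lam ≠ 0)
    (hg : MemLp (ThreeLevel.thermalFormFactor M.β M.g) 2 ThreeLevel.modeMeasure)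
    (hreg : ∃ a : ℝ, 0 < a ∧
      (fun ω => ThreeLevel.spectralDensity M.g ω - ThreeLevel.spectralDensity M.g M.gap)
        =O[𝓝 M.gap] fun ω => |ω - M.gap| ^ a)
    (hJ : 0 < ThreeLevel.spectralDensity M.g M.gap) :
    (∀ e : ℝ, e = 0 ∨ e = M.gap ∨ e = -M.gap →
      Tendsto (M.regLevelShift 0 lam e) (𝓝[>] 0) (𝓝 (M.levelShift 0 lam e))) ∧
    ∀ ρ : Matrix (Fin 3) (Fin 3) ℂ,
      ((ThreeLevel.IsDensityMatrix ρ ∧ ∀ t : ℝ, 0 ≤ t → M.approxDynamics 0 lam t ρ = ρ) ↔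
        ∃ p α : ℝ, p ∈ Set.Icc 0 (Real.exp (M.β * M.gap) + 1)⁻¹ ∧
          α = ((2 * Real.exp (M.β * M.gap) + 1) * p - 1) / 2 ∧
          ρ = !![(p : ℂ), 0, 0;
                 0, (1 - p) / 2, α;
                 0, α, (1 - p) / 2]) ∧
      ((ThreeLevel.IsDensityMatrix ρ ∧ ∀ t : ℝ, 0 ≤ t → M.approxDynamics 0 lam t ρ = ρ) ↔
        ∃ μ : ℝ, μ ∈ Set.Icc 0
            ((1 + 2 * Real.exp (M.β * M.gap)) / (1 + Real.exp (M.β * M.gap))) ∧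
          ρ = (μ : ℂ) • M.gibbs 0 + (1 - μ : ℂ) • ThreeLevel.darkState) := by
  obtain ⟨s, r, c, hc, hx, hy⟩ := M.exists_tendsto_selfEnergy hgap hβ hg hreg hJ
  have hX : 0 < Real.exp (M.β * M.gap) := Real.exp_pos _
  have key : ∀ ρ : Matrix (Fin 3) (Fin 3) ℂ,
      (ThreeLevel.IsDensityMatrix ρ ∧ ∀ t : ℝ, 0 ≤ t → M.approxDynamics 0 lam t ρ = ρ) ↔
        ∃ p α : ℝ, p ∈ Set.Icc 0 (Real.exp (M.β * M.gap) + 1)⁻¹ ∧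
          α = ((2 * Real.exp (M.β * M.gap) + 1) * p - 1) / 2 ∧
          ρ = ThreeLevel.invariantState p α := fun ρ => by
    rw [← ThreeLevel.density_kernel_iff hX]
    exact and_congr_right fun hρ => M.invariant_iff hgap hβ hlam hc hx hy hρ.1
  refine ⟨fun e _ => ?_, fun ρ => ⟨key ρ, (key ρ).trans ?_⟩⟩
  · rw [M.levelShift_eq hβ lam e hx hy]
    exact M.tendsto_regLevelShift hβ lam e hx hy
  have hX1 : 0 < 1 + 2 * Real.exp (M.β * M.gap) := by positivity
  have hX2 : 0 < 1 + Real.exp (M.β * M.gap) := by positivity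
  constructor
  · rintro ⟨p, α, ⟨hp0, hp1⟩, rfl, rfl⟩
    -- The dark state does not occupy the excited level, so matching that entry determines `μ`; the
    -- formula for `α` then reads `(μ - 1) / 2`.
    refine ⟨(1 + 2 * Real.exp (M.β * M.gap)) * p, ⟨by positivity, ?_⟩, ?_⟩
    · rw [div_eq_mul_inv, add_comm 1 (Real.exp _)]
      gcongr
    · rw [M.mixture_eq_invariantState, mul_div_cancel_left₀ _ hX1.ne', add_comm 1 (2 * _)]
  · rintro ⟨μ, ⟨hμ0, hμ1⟩, rfl⟩
    refine ⟨_, _, ⟨by positivity, ?_⟩, ?_, M.mixture_eq_invariantState μ⟩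
    · rw [div_le_iff₀ hX1, inv_mul_eq_div, add_comm _ (1 : ℝ)]
      exact hμ1
    · field_simp
      ring
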